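/- Let $p\ge 5$ be a prime and let $k$ be an algebraic closure of $\mathbb F_p$ (the residue field of the completion $R$ of the maximal unramified extension of $\mathbb Z_p$). Definitions. Let $\delta P=(\phi(P)-P^p)/p\in\mathbb Z[q_1,\dots,q_p,q_1',\dots,q_p']$ for $P\in\mathbb Z[q_1,\dots,q_p]$, where $\phi$ is the ring homomorphism $q_i\mapsto q_i^p+pq_i'$, and let $S_1,\dots,S_p$ be the elementary symmetric polynomials in $q_1,\dots,q_p$. Consider the $k$-algebra homomorphisms $$k[[s_1,\dots,s_p]][s_1',\dots,s_p']\to k[[q_1,\dots,q_p]][q_1',\dots,q_p'],$$ $$k[[s_1,\dots,s_p]][s_p^{-1}][s_1',\dots,s_p']\to k[[q_1,\dots,q_p]][(q_1\cdots q_p)^{-1}][q_1',\dots,q_p'],$$ given by substituting $s_j\mapsto S_j$ and $s_j'\mapsto\delta S_j \bmod p$. An element $\overline f\in k[[q]][q']$ (respectively $\overline f\in k((q))[q']$) is *Taylor* (respectively *Laurent*) *$\delta$-$p$-symmetric* if $\Sigma_p\overline f:=\sum_{j=1}^p\overline f(q_j,q_j')$ is the image under the first (respectively second) homomorphism of an element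 $(\Sigma_p\overline f)_{(p)}$, which is then unique. For a Laurent $\delta$-$p$-symmetric $\overline f$ put $$``pU"\overline f:=(\Sigma_p\overline f)_{(p)}(0,\dots,0,q,0,\dots,0,q')\in k((q))[q'],$$ i.e. $s_p\mapsto q$, $s_p'\mapsto q'$, and $s_j,s_j'\mapsto 0$ for $j<p$. On $k((q))$ let $V(\sum a_nq^n)=\sum a_nq^{pn}$, $U(\sum a_nq^n)=\sum a_{pn}q^n$, $\theta=q\frac{d}{dq}$ and $\varphi^{(-1)}:=\theta^{p-2}\varphi$ (so $\varphi^{(-1)}=\sum_{(n,p)=1}\frac{a_n}{n}q^n$ for $\varphi=\sum a_nq^n$). Theorem. Let $\varphi_0,\varphi_1,\varphi_p,\varphi_{p^2},\dots\in k((q))$, with all but finitely many $\varphi_{p^s}$ equal to $0$, and let $$\overline f=\varphi_0+\sum_{s\ge 0}V^{s+1}(\varphi_{p^s})\left(\frac{q'}{q^p}\right)^{p^s}\in k((q))[q'].$$ Then $\overline f$ is Laurent $\delta$-$p$-symmetric and $$``pU"\overline f=-\sum_{s\ge 0}V^s\bigl(\varphi_{p^s}^{(-1)}\bigr)+\sum_{s\ge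 0}V^{s+1}(U\varphi_{p^s})\left(\frac{q'}{q^p}\right)^{p^s}.$$ Moreover $\overline f\in k[[q]][q']$ if and only if $\varphi_0\in k[[q]]$ and $\varphi_{p^s}\in qk[[q]]$ for all $s\ge 0$, and in that case $\overline f$ is Taylor $\delta$-$p$-symmetric. -/

import Mathlib

/-!
# Delta-p-symmetric series mod `p` of order one

`p` is a prime and `k` is the residue field of the completed maximal unramified extension `R` of
`ℤ_p`. All rings below are the reductions mod `p` of the corresponding `p`-adically completed rings
of `δ`-series of order one over `R`; completing `p`-adically does not change a ring mod `p`. The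
indeterminate with (zero-based) index `i : Fin p` is the one usually numbered `i + 1`.
-/

namespace DeltaSeries

noncomputable section

/-! ## The `p`-derivation on integral polynomials -/

/-- The ring `ℤ[q_1, …, q_p, q_1', …, q_p']`: `Sum.inl i` indexes `q_i` and `Sum.inr i` indexes
`q_i'`. -/
abbrev IntJet (p : ℕ) : Type := MvPolynomial (Fin p ⊕ Fin p) ℤ

/-- The inclusion `ℤ[q_1, …, q_p] → ℤ[q_1, …, q_p, q_1', …, q_p']`. -/
def incl (p : ℕ) : MvPolynomial (Fin p) ℤ →ₐ[ℤ] IntJet p := MvPolynomial.rename Sum.inl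

/-- The lift of Frobenius `φ`, the ring homomorphism with `φ(q_i) = q_i ^ p + p q_i'`. -/
def phi (p : ℕ) : MvPolynomial (Fin p) ℤ →ₐ[ℤ] IntJet p :=
  MvPolynomial.aeval fun i =>
    MvPolynomial.X (Sum.inl i) ^ p + (p : IntJet p) * MvPolynomial.X (Sum.inr i)

theorem dvd_phi_sub_pow (p : ℕ) [Fact p.Prime] (P : MvPolynomial (Fin p) ℤ) :
    (p : IntJet p) ∣ phi p P - incl p P ^ p := by
  have h := MvPolynomial.C_dvd_iff_zmod p (phi p P - incl p P ^ p)
  rw [show (MvPolynomial.C ((p : ℕ) : ℤ) : IntJet p) = (p : IntJet p) by simp] at h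
  rw [h, map_sub, map_pow, sub_eq_zero]
  set red := MvPolynomial.map (σ := Fin p ⊕ Fin p) (Int.castRingHom (ZMod p))
  have key : red.comp (phi p).toRingHom =
      (frobenius (MvPolynomial (Fin p ⊕ Fin p) (ZMod p)) p).comp
        (red.comp (incl p).toRingHom) := by
    apply MvPolynomial.ringHom_ext
    · intro r
      simp
    · intro i
      simp [phi, incl, red, frobenius_def]
  exact congrArg (fun g => g P) key

/-- The `p`-derivation `δ P = (φ(P) - P ^ p) / p` on integral polynomials, so that
`δ q_i = q_i'`. -/
def delta (p : ℕ) [Fact p.Prime] (P : MvPolynomial (Fin p) ℤ) : IntJet p :=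
  Classical.choose (dvd_phi_sub_pow p P)

theorem p_mul_delta (p : ℕ) [Fact p.Prime] (P : MvPolynomial (Fin p) ℤ) :
    (p : IntJet p) * delta p P = phi p P - incl p P ^ p :=
  (Classical.choose_spec (dvd_phi_sub_pow p P)).symm

/-- The last index `p` (that is, `p - 1` in zero-based numbering). -/
def lastIdx (p : ℕ) [Fact p.Prime] : Fin p :=
  ⟨p - 1, Nat.sub_lt (Fact.out : p.Prime).pos Nat.one_pos⟩

/-! ## The coefficient homomorphisms -/

section Coefficients

variable (p : ℕ) (k : Type*) [Field k]

/-- The elementary symmetric polynomial `S_{i+1}` in `q_1, …, q_p`, as a power series over `k`. -/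
def symmSeries (i : Fin p) : MvPowerSeries (Fin p) k :=
  ((MvPolynomial.esymm (Fin p) k ((i : ℕ) + 1) : MvPolynomial (Fin p) k) :
    MvPowerSeries (Fin p) k)

theorem hasSubst_symmSeries : MvPowerSeries.HasSubst (symmSeries p k) := by
  apply MvPowerSeries.hasSubst_of_constantCoeff_zero
  intro i
  have h : MvPolynomial.constantCoeff (MvPolynomial.esymm (Fin p) k ((i : ℕ) + 1)) = 0 := by
    rw [MvPolynomial.esymm, map_sum]
    refine Finset.sum_eq_zero fun t ht => ?_
    obtain ⟨j, hj⟩ : t.Nonempty := by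
      rw [← Finset.card_pos, (Finset.mem_powersetCard.mp ht).2]
      exact Nat.succ_pos _
    rw [map_prod]
    exact Finset.prod_eq_zero hj (by simp)
  rw [symmSeries, ← MvPowerSeries.coeff_zero_eq_constantCoeff_apply, MvPolynomial.coeff_coe]
  simpa [MvPolynomial.constantCoeff_eq] using h

/-- `k[[s_1, …, s_p]] → k[[q_1, …, q_p]]`, `s_j ↦ S_j`. -/
def taylorCoeffHom : MvPowerSeries (Fin p) k →+* MvPowerSeries (Fin p) k :=
  (MvPowerSeries.substAlgHom (R := k) (hasSubst_symmSeries p k)).toRingHom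

variable [Fact p.Prime]

/-- `k[[s_1, …, s_p]][s_p⁻¹]`. -/
abbrev LaurentS : Type _ :=
  Localization.Away (MvPowerSeries.X (lastIdx p) : MvPowerSeries (Fin p) k)

/-- `k[[q_1, …, q_p]][(q_1 ⋯ q_p)⁻¹]`. -/
abbrev LaurentQ : Type _ :=
  Localization.Away (∏ i : Fin p, MvPowerSeries.X i : MvPowerSeries (Fin p) k)

theorem taylorCoeffHom_X_lastIdx :
    taylorCoeffHom p k (MvPowerSeries.X (lastIdx p)) = ∏ i : Fin p, MvPowerSeries.X i := by
  have hp : ((lastIdx p : Fin p) : ℕ) + 1 = p :=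
    Nat.sub_add_cancel (Fact.out : p.Prime).one_le
  have he : MvPolynomial.esymm (Fin p) k p = ∏ i : Fin p, MvPolynomial.X i := by
    have h := Finset.powersetCard_self (Finset.univ : Finset (Fin p))
    rw [Finset.card_univ, Fintype.card_fin] at h
    rw [MvPolynomial.esymm, h, Finset.sum_singleton]
  change MvPowerSeries.substAlgHom (hasSubst_symmSeries p k) _ = _
  rw [MvPowerSeries.substAlgHom_X, symmSeries, hp, he]
  rw [← MvPolynomial.coeToMvPowerSeries.ringHom_apply, map_prod]
  simp only [MvPolynomial.coeToMvPowerSeries.ringHom_apply, MvPolynomial.coe_X]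

/-- `k[[s_1, …, s_p]][s_p⁻¹] → k[[q_1, …, q_p]][(q_1 ⋯ q_p)⁻¹]`, `s_j ↦ S_j`. -/
def laurentCoeffHom : LaurentS p k →+* LaurentQ p k :=
  IsLocalization.Away.lift (MvPowerSeries.X (lastIdx p))
    (g := (algebraMap (MvPowerSeries (Fin p) k) (LaurentQ p k)).comp (taylorCoeffHom p k))
    (by
      rw [RingHom.comp_apply, taylorCoeffHom_X_lastIdx]
      exact IsLocalization.Away.algebraMap_isUnit _)

/-- `k[[q]] → k[[q_1, …, q_p]]`, `q ↦ q_j`. -/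
def taylorVar (j : Fin p) : PowerSeries k →+* MvPowerSeries (Fin p) k :=
  (PowerSeries.substAlgHom (R := k)
    (PowerSeries.HasSubst.X j : PowerSeries.HasSubst
      (MvPowerSeries.X j : MvPowerSeries (Fin p) k))).toRingHom

/-- `k((q)) → k[[q_1, …, q_p]][(q_1 ⋯ q_p)⁻¹]`, `q ↦ q_j`. -/
def laurentVar (j : Fin p) : LaurentSeries k →+* LaurentQ p k :=
  IsLocalization.Away.lift (PowerSeries.X : PowerSeries k)
    (g := (algebraMap (MvPowerSeries (Fin p) k) (LaurentQ p k)).comp (taylorVar p k j))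
    (by
      have h : taylorVar p k j PowerSeries.X = MvPowerSeries.X j := by
        change PowerSeries.substAlgHom (PowerSeries.HasSubst.X j) PowerSeries.X = _
        rw [PowerSeries.coe_substAlgHom, PowerSeries.subst_X (PowerSeries.HasSubst.X j)]
      rw [RingHom.comp_apply, h]
      exact isUnit_of_dvd_unit
        (map_dvd (algebraMap (MvPowerSeries (Fin p) k) (LaurentQ p k))
          (Finset.dvd_prod_of_mem (fun i => (MvPowerSeries.X i : MvPowerSeries (Fin p) k))
            (Finset.mem_univ j)))
        (IsLocalization.Away.algebraMap_isUnit _))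

theorem hasSubst_spec :
    MvPowerSeries.HasSubst
      (fun i : Fin p => if i = lastIdx p then (PowerSeries.X : PowerSeries k) else 0) := by
  apply MvPowerSeries.hasSubst_of_constantCoeff_zero
  intro i
  split_ifs
  · exact PowerSeries.constantCoeff_X
  · exact map_zero _

/-- `k[[s_1, …, s_p]][s_p⁻¹] → k((q))`, `(s_1, …, s_{p-1}, s_p) ↦ (0, …, 0, q)`. -/
def laurentSpecCoeff : LaurentS p k →+* LaurentSeries k :=
  IsLocalization.Away.lift (MvPowerSeries.X (lastIdx p))
    (g := (algebraMap (PowerSeries k) (LaurentSeries k)).comp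
      (MvPowerSeries.substAlgHom (R := k) (hasSubst_spec p k)).toRingHom)
    (by
      have h : (MvPowerSeries.substAlgHom (R := k) (hasSubst_spec p k)).toRingHom
          (MvPowerSeries.X (lastIdx p)) = (PowerSeries.X : PowerSeries k) := by
        change MvPowerSeries.substAlgHom (hasSubst_spec p k) _ = _
        rw [MvPowerSeries.substAlgHom_X, if_pos rfl]
      rw [RingHom.comp_apply, h]
      exact IsLocalization.Away.algebraMap_isUnit _)

end Coefficients

/-! ## Symmetry -/

section Symmetry

variable {p : ℕ} [Fact p.Prime] {k : Type*} [Field k]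

variable (p k) in
/-- `k[[s_1, …, s_p]][s_1', …, s_p'] → k[[q_1, …, q_p]][q_1', …, q_p']`,
`s_j ↦ S_j`, `s_j' ↦ δ S_j`. -/
def taylorHom : MvPolynomial (Fin p) (MvPowerSeries (Fin p) k) →+*
    MvPolynomial (Fin p) (MvPowerSeries (Fin p) k) :=
  MvPolynomial.eval₂Hom (MvPolynomial.C.comp (taylorCoeffHom p k)) fun i =>
    MvPolynomial.aeval
      (Sum.elim (fun j => MvPolynomial.C (MvPowerSeries.X j)) fun j => MvPolynomial.X j)
      (delta p (MvPolynomial.esymm (Fin p) ℤ ((i : ℕ) + 1)))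

variable (p k) in
/-- `k[[s_1, …, s_p]][s_p⁻¹][s_1', …, s_p'] → k[[q_1, …, q_p]][(q_1 ⋯ q_p)⁻¹][q_1', …, q_p']`,
`s_j ↦ S_j`, `s_j' ↦ δ S_j`. -/
def laurentHom : MvPolynomial (Fin p) (LaurentS p k) →+* MvPolynomial (Fin p) (LaurentQ p k) :=
  MvPolynomial.eval₂Hom (MvPolynomial.C.comp (laurentCoeffHom p k)) fun i =>
    MvPolynomial.aeval
      (Sum.elim
        (fun j => MvPolynomial.C
          (algebraMap (MvPowerSeries (Fin p) k) (LaurentQ p k) (MvPowerSeries.X j)))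
        fun j => MvPolynomial.X j)
      (delta p (MvPolynomial.esymm (Fin p) ℤ ((i : ℕ) + 1)))

variable (p) in
/-- `Σ_p f = f(q_1, q_1') + ⋯ + f(q_p, q_p')` for `f ∈ k[[q]][q']`. -/
def taylorSigma (f : Polynomial (PowerSeries k)) :
    MvPolynomial (Fin p) (MvPowerSeries (Fin p) k) :=
  ∑ j : Fin p, f.eval₂ (MvPolynomial.C.comp (taylorVar p k j)) (MvPolynomial.X j)

variable (p) in
/-- `Σ_p f = f(q_1, q_1') + ⋯ + f(q_p, q_p')` for `f ∈ k((q))[q']`. -/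
def laurentSigma (f : Polynomial (LaurentSeries k)) : MvPolynomial (Fin p) (LaurentQ p k) :=
  ∑ j : Fin p, f.eval₂ (MvPolynomial.C.comp (laurentVar p k j)) (MvPolynomial.X j)

variable (p) in
/-- `f ∈ k[[q]][q']` is Taylor `δ`-`p`-symmetric: `Σ_p f` is the image of some element of
`k[[s_1, …, s_p]][s_1', …, s_p']`, which is then unique. -/
def IsTaylorSymmetric (f : Polynomial (PowerSeries k)) : Prop :=
  ∃! G : MvPolynomial (Fin p) (MvPowerSeries (Fin p) k), taylorHom p k G = taylorSigma p f

variable (p) in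
/-- `f ∈ k((q))[q']` is Laurent `δ`-`p`-symmetric: `Σ_p f` is the image of some element of
`k[[s_1, …, s_p]][s_p⁻¹][s_1', …, s_p']`, which is then unique. -/
def IsLaurentSymmetric (f : Polynomial (LaurentSeries k)) : Prop :=
  ∃! G : MvPolynomial (Fin p) (LaurentS p k), laurentHom p k G = laurentSigma p f

variable (p k) in
/-- The specialization `G ↦ G(0, …, 0, q, 0, …, 0, q')`, i.e. `s_p ↦ q`, `s_p' ↦ q'`, and
`s_j, s_j' ↦ 0` for `j < p`. -/
def laurentSpec : MvPolynomial (Fin p) (LaurentS p k) →+* Polynomial (LaurentSeries k) :=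
  MvPolynomial.eval₂Hom (Polynomial.C.comp (laurentSpecCoeff p k)) fun i =>
    if i = lastIdx p then Polynomial.X else 0

/-- `"pU" f = (Σ_p f)_{(p)}(0, …, 0, q, 0, …, 0, q')`, where `(Σ_p f)_{(p)}` is the unique
preimage of `Σ_p f`. -/
def pU (f : Polynomial (LaurentSeries k)) (hf : IsLaurentSymmetric p f) :
    Polynomial (LaurentSeries k) :=
  laurentSpec p k hf.choose

end Symmetry

/-! ## Operators on `k((q))` -/

section Operators

variable (p : ℕ) [Fact p.Prime] {k : Type*} [Field k]

/-- `V (∑ a_n q^n) = ∑ a_n q^{pn}`. -/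
def V : LaurentSeries k →+* LaurentSeries k :=
  HahnSeries.embDomainRingHom (AddMonoidHom.mulLeft (p : ℤ))
    (fun _ _ h => mul_left_cancel₀
      (Int.natCast_ne_zero.mpr (Fact.out : p.Prime).ne_zero) h)
    (fun _ _ => mul_le_mul_iff_right₀
      (Int.natCast_pos.mpr (Fact.out : p.Prime).pos))

/-- `U (∑ a_n q^n) = ∑ a_{pn} q^n`. -/
def U (f : LaurentSeries k) : LaurentSeries k :=
  HahnSeries.ofSuppBddBelow (fun n : ℤ => f.coeff ((p : ℤ) * n)) (by
    refine ⟨min 0 f.order, fun n hn => ?_⟩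
    have h1 : f.order ≤ (p : ℤ) * n := HahnSeries.order_le_of_coeff_ne_zero hn
    have h2 : (1 : ℤ) ≤ p := by exact_mod_cast (Fact.out : p.Prime).one_le
    rcases le_or_gt 0 n with h | h
    · exact (min_le_left _ _).trans h
    · exact (min_le_right _ _).trans (by nlinarith))

/-- `θ = q d/dq`, i.e. `θ (∑ a_n q^n) = ∑ n a_n q^n`. -/
def theta (f : LaurentSeries k) : LaurentSeries k :=
  HahnSeries.ofSuppBddBelow (fun n : ℤ => (n : k) * f.coeff n)
    ⟨f.order, fun _ hn => HahnSeries.order_le_of_coeff_ne_zero (right_ne_zero_of_mul hn)⟩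

/-- `φ^{(-1)} = θ^{p-2} φ`. -/
def negOne (f : LaurentSeries k) : LaurentSeries k := theta^[p - 2] f

/-- The element `q' / q^p` of `k((q))[q']`. -/
def qPrimeDiv : Polynomial (LaurentSeries k) :=
  Polynomial.C (HahnSeries.single (-(p : ℤ)) (1 : k)) * Polynomial.X

/-- The series `φ_0 + ∑_s V^{s+1}(φ_{p^s}) (q'/q^p)^{p^s}` in `k((q))[q']`, where `φ s` stands for
`φ_{p^s}`. It is a polynomial in `q'`, so all but finitely many `φ_{p^s}` vanish. -/
def series (φ₀ : LaurentSeries k) (φ : ℕ →₀ LaurentSeries k) : Polynomial (LaurentSeries k) :=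
  Polynomial.C φ₀ +
    ∑ s ∈ φ.support, Polynomial.C ((V p)^[s + 1] (φ s)) * qPrimeDiv p ^ (p ^ s)

end Operators

end

end DeltaSeries

/-! Write `e_i(ĵ)` for the elementary symmetric function of degree `i` in all the `q_l` except
`q_j`; it equals `∂S_{i+1}/∂q_j`. Expanding `φ(S_{i+1})` to first order in `p` gives, mod `p`,
`δS_{i+1} = ∑_j e_i(ĵ)^p q_j' + T_{i+1}(S)`, where `p T_n(S) = S_n(q^p) - S_n^p`
(`aeval_delta_esymm`).

Every series has an expansion `χ(q_j) = ∑_{i<p} c_i e_i(ĵ)` whose coefficients `c_i` are symmetric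
and do not depend on `j` (`taylorVar_eq_expansion`, `exists_isExpansion`). Summing over `j` gives `∑
χ(q_j) = ∑ (p-i) c_i s_i`. Taking `p`-th powers first gives `∑ χ(q_j)^p q_j' = ∑ c_i^p (s_{i+1}' -
T_{i+1}(s))`. Thus `χ` and `χ^p q'` are `δ`-`p`-symmetric, with explicit preimages.

The general series reduces to these two. Since `k` is perfect, `φ_{p^s}` comes from some `ρ` by
raising coefficients to the power `p^{s+1}`, and the term with index `s` is then `((q⁻¹ρ)^p
q')^{p^s}` (`series_eq_sum_pow`). Frobenius is additive, so it commutes with `Σ_p`.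

At `s = (0, …, 0, q)` the `q_l` become the roots of `X^p - q`. There `c_i` becomes `(-1)^i ∑
a_{pr+i} q^r`, and `T_{i+1}` becomes `(p.choose (i+1) / p) q^{i+1}` for `i + 1 < p` and `0` for `i +
1 = p`. Modulo `p` that binomial quotient is `(-1)^i / (i+1)`, which produces `φ^{(-1)}`; the top
coefficient `c_{p-1}` produces `U`.

Preimages are unique because the `S_i` are algebraically independent and the matrix `(e_i(ĵ)^p)` is
nonsingular, by reduction to a Vandermonde matrix (`eval₂Hom_injective`). -/

namespace DeltaSeries

noncomputable section

open MvPolynomial Finset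

/-! ## Elementary symmetric functions of finitely many elements -/

section EsymmAt

variable {ι Q : Type*} [CommRing Q]

/-- The elementary symmetric function of degree `n` in the `x l`, for `l` in a finite set `s`. -/
def esymmAt (x : ι → Q) (s : Finset ι) (n : ℕ) : Q :=
  ∑ t ∈ s.powersetCard n, ∏ l ∈ t, x l

theorem esymmAt_zero (x : ι → Q) (s : Finset ι) : esymmAt x s 0 = 1 := by
  simp [esymmAt]

theorem esymmAt_of_card_lt (x : ι → Q) {s : Finset ι} {n : ℕ} (h : #s < n) :
    esymmAt x s n = 0 := by
  rw [esymmAt, powersetCard_eq_empty.mpr h, sum_empty]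

/-- Subsets of size `n + 1` split according to whether they contain `j`. This recursion drives both
the expansions and the Vandermonde reduction below. -/
theorem esymmAt_erase [DecidableEq ι] (x : ι → Q) {s : Finset ι} {j : ι} (hj : j ∈ s) (n : ℕ) :
    esymmAt x (s.erase j) (n + 1) + x j * esymmAt x (s.erase j) n = esymmAt x s (n + 1) := by
  have hd : Disjoint ((s.erase j).powersetCard (n + 1))
      (((s.erase j).powersetCard n).image (insert j)) := by
    rw [disjoint_left]
    rintro t ht ht'
    obtain ⟨u, -, rfl⟩ := mem_image.mp ht'
    exact notMem_erase j s ((mem_powersetCard.mp ht).1 (mem_insert_self j u))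
  have hn : ∀ t ∈ (s.erase j).powersetCard n, j ∉ t := fun t ht h =>
    notMem_erase j s ((mem_powersetCard.mp ht).1 h)
  conv_rhs => rw [esymmAt, ← insert_erase hj, powersetCard_succ_insert (notMem_erase _ _),
    sum_union hd]
  rw [sum_image]
  · rw [esymmAt, esymmAt, mul_sum]
    congr 1
    exact sum_congr rfl fun t ht => (prod_insert (hn t ht)).symm
  · intro t ht u hu h
    rw [← erase_insert (hn t ht), ← erase_insert (hn u hu)]
    exact congrArg (fun v => v.erase j) h

theorem map_esymmAt {A : Type*} [CommRing A] (f : Q →+* A) (x : ι → Q) (s : Finset ι) (n : ℕ) :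
    f (esymmAt x s n) = esymmAt (fun l => f (x l)) s n := by
  simp [esymmAt, map_sum, map_prod]

theorem esymmAt_pow_char (p : ℕ) [Fact p.Prime] [CharP Q p] (x : ι → Q) (s : Finset ι) (n : ℕ) :
    esymmAt (fun l => x l ^ p) s n = esymmAt x s n ^ p :=
  (map_esymmAt (frobenius Q p) x s n).symm

variable [Fintype ι]

theorem aeval_esymm {R : Type*} [CommRing R] [Algebra R Q] (x : ι → Q) (n : ℕ) :
    aeval x (esymm ι R n) = esymmAt x univ n := by
  simp [esymm, esymmAt, map_sum, map_prod]

theorem esymm_eq_esymmAt {R : Type*} [CommRing R] (n : ℕ) :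
    esymm ι R n = esymmAt (X : ι → MvPolynomial ι R) univ n := rfl

theorem esymmAt_const (y : Q) (n : ℕ) :
    esymmAt (fun _ : ι => y) univ n = (Fintype.card ι).choose n * y ^ n := by
  rw [esymmAt, sum_congr rfl (g := fun _ => y ^ n)]
  · simp [card_powersetCard]
  · intro t ht
    rw [prod_const, (mem_powersetCard.mp ht).2]

variable [DecidableEq ι]

/-- Double counting: a subset of size `n` avoids exactly `card - n` indices `j`. -/
theorem sum_esymmAt_erase (x : ι → Q) (n : ℕ) :
    ∑ j, esymmAt x (univ.erase j) n = ((Fintype.card ι - n : ℕ) : Q) * esymmAt x univ n := by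
  simp only [esymmAt]
  rw [sum_comm' (t' := univ.powersetCard n) (s' := fun t => univ \ t), mul_sum]
  · refine sum_congr rfl fun t ht => ?_
    rw [sum_const, card_univ_sdiff, (mem_powersetCard.mp ht).2, nsmul_eq_mul]
  · intro j t
    simp only [mem_univ, mem_powersetCard, subset_univ, true_and, mem_sdiff]
    rw [and_comm, subset_erase]
    simp [and_comm]

theorem pderiv_esymm {R : Type*} [CommRing R] (j : ι) (n : ℕ) :
    pderiv j (esymm ι R (n + 1)) = esymmAt X (univ.erase j) n := by
  have h : ∀ m, pderiv j (esymmAt (X : ι → MvPolynomial ι R) (univ.erase j) m) = 0 := by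
    intro m
    rw [esymmAt, map_sum]
    refine sum_eq_zero fun t ht => ?_
    refine prod_induction _ (fun P => pderiv j P = 0) (fun P P' hP hP' => ?_) (by simp) ?_
    · simp [Derivation.leibniz, hP, hP']
    · intro l hl
      refine pderiv_X_of_ne ?_
      rintro rfl
      exact notMem_erase _ _ ((mem_powersetCard.mp ht).1 hl)
  rw [esymm_eq_esymmAt, ← esymmAt_erase X (mem_univ j), map_add, Derivation.leibniz, h, h,
    pderiv_X_self]
  simp

/-- First order Taylor expansion of a polynomial. -/
theorem exists_aeval_add_mul [Algebra ℤ Q] (a : Q) (x y : ι → Q) (P : MvPolynomial ι ℤ) :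
    ∃ r, aeval (fun l => x l + a * y l) P =
      aeval x P + a * ∑ j, aeval x (pderiv j P) * y j + a ^ 2 * r := by
  induction P using MvPolynomial.induction_on with
  | C c => exact ⟨0, by simp⟩
  | add P P' h h' =>
    obtain ⟨r, hr⟩ := h
    obtain ⟨r', hr'⟩ := h'
    refine ⟨r + r', ?_⟩
    rw [map_add, hr, hr', map_add]
    simp only [map_add, add_mul, sum_add_distrib]
    ring
  | mul_X P i h =>
    obtain ⟨r, hr⟩ := h
    -- Multiplying the expansion of `P` by `x i + a * y i`, these are the terms of order at least
    -- two in `a`.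
    refine ⟨r * (x i + a * y i) + (∑ j, aeval x (pderiv j P) * y j) * y i, ?_⟩
    have hs : ∑ j, aeval x (pderiv j (P * X i)) * y j =
        (∑ j, aeval x (pderiv j P) * y j) * x i + aeval x P * y i := by
      rw [sum_mul]
      simp only [Derivation.leibniz, pderiv_X, smul_eq_mul, map_add, map_mul, aeval_X, add_mul,
        sum_add_distrib]
      rw [add_comm]
      congr 1
      · exact sum_congr rfl fun j _ => by ring
      · rw [sum_eq_single i]
        · simp
        · intro j _ hj
          simp [hj]
        · simp
    rw [map_mul, hr, hs, map_mul, aeval_X, aeval_X]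
    ring

end EsymmAt

/-! ## The `p`-derivation of the elementary symmetric polynomials -/

theorem map_aeval_int {ι A B : Type*} [CommRing A] [CommRing B] [Algebra ℤ A]
    [Algebra ℤ B] (f : A →+* B) (x : ι → A)
    (P : MvPolynomial ι ℤ) : f (aeval x P) = aeval (fun l => f (x l)) P := by
  rw [aeval_def, aeval_def, eval₂_eq_eval_map, eval₂_eq_eval_map, eval_map, eval_map,
    hom_eval₂, RingHom.ext_int (f.comp (algebraMap ℤ A)) (algebraMap ℤ B)]

section Delta

variable (p : ℕ) [Fact p.Prime]

/-- Modulo `p`, substituting `q_i ^ p` is the same as taking the `p`-th power, so the difference is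
divisible by `p`. The quotient is symmetric because `p` can be cancelled, and the fundamental
theorem of symmetric polynomials applies. -/
theorem exists_powDefect (n : ℕ) : ∃ T : MvPolynomial (Fin p) ℤ,
    (p : MvPolynomial (Fin p) ℤ) * aeval (fun l : Fin p => esymm (Fin p) ℤ (l + 1)) T =
      expand p (esymm (Fin p) ℤ n) - esymm (Fin p) ℤ n ^ p := by
  have hp0 : (p : MvPolynomial (Fin p) ℤ) ≠ 0 :=
    Nat.cast_ne_zero.mpr (Fact.out : p.Prime).ne_zero
  have hdvd : (p : MvPolynomial (Fin p) ℤ) ∣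
      expand p (esymm (Fin p) ℤ n) - esymm (Fin p) ℤ n ^ p := by
    have h := C_dvd_iff_zmod p (expand p (esymm (Fin p) ℤ n) - esymm (Fin p) ℤ n ^ p)
    rw [show (C ((p : ℕ) : ℤ) : MvPolynomial (Fin p) ℤ) = (p : MvPolynomial (Fin p) ℤ) by simp] at h
    rw [h, map_sub, map_pow, map_expand, expand_zmod, sub_self]
  obtain ⟨D, hD⟩ := hdvd
  have hsymm : D.IsSymmetric := by
    intro e
    apply mul_left_cancel₀ hp0
    have h := congrArg (rename e) hD
    rw [map_mul, map_natCast, map_sub, map_pow, rename_expand, rename_esymm, hD] at h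
    exact h.symm
  obtain ⟨T, hT⟩ := esymmAlgHom_fin_surjective (R := ℤ) (n := p) (m := p) le_rfl ⟨D, hsymm⟩
  refine ⟨T, ?_⟩
  have h2 := congrArg Subtype.val hT
  rw [esymmAlgHom_apply] at h2
  rw [h2, hD]

/-- The polynomial `T_n` over `ℤ` with `p T_n(S_1, …, S_p) = S_n(q_1 ^ p, …, q_p ^ p) - S_n ^ p`. -/
def powDefect (n : ℕ) : MvPolynomial (Fin p) ℤ := (exists_powDefect p n).choose

theorem p_mul_aeval_powDefect (n : ℕ) :
    (p : MvPolynomial (Fin p) ℤ) *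
        aeval (fun l : Fin p => esymm (Fin p) ℤ (l + 1)) (powDefect p n) =
      expand p (esymm (Fin p) ℤ n) - esymm (Fin p) ℤ n ^ p :=
  (exists_powDefect p n).choose_spec

/-- Taylor expansion of `φ(S_{n+1})` at the point `q^p` with increment `p q'`: the constant term
minus `S_{n+1}^p` is the power defect, and the linear term carries the derivatives. -/
theorem exists_delta_esymm (n : ℕ) : ∃ r : IntJet p,
    delta p (esymm (Fin p) ℤ (n + 1)) =
      ∑ j, esymmAt (fun l => X (Sum.inl l) ^ p) (univ.erase j) n * X (Sum.inr j) +
        incl p (aeval (fun l : Fin p => esymm (Fin p) ℤ (l + 1)) (powDefect p (n + 1))) +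
        (p : IntJet p) * r := by
  have hp0 : (p : IntJet p) ≠ 0 := Nat.cast_ne_zero.mpr (Fact.out : p.Prime).ne_zero
  obtain ⟨r, hr⟩ := exists_aeval_add_mul (p : IntJet p) (fun l : Fin p => X (Sum.inl l) ^ p)
    (fun l => X (Sum.inr l)) (esymm (Fin p) ℤ (n + 1))
  refine ⟨r, mul_left_cancel₀ hp0 ?_⟩
  have h1 : (p : IntJet p) *
      incl p (aeval (fun l : Fin p => esymm (Fin p) ℤ (l + 1)) (powDefect p (n + 1))) =
      aeval (fun l : Fin p => (X (Sum.inl l) ^ p : IntJet p)) (esymm (Fin p) ℤ (n + 1)) -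
        incl p (esymm (Fin p) ℤ (n + 1)) ^ p := by
    have h := congrArg (incl p) (p_mul_aeval_powDefect p (n + 1))
    rw [map_mul, map_natCast, map_sub, map_pow] at h
    rw [h]
    congr 1
    rw [← AlgHom.coe_toRingHom (incl p), expand, ← aeval_eq_bind₁, map_aeval_int]
    simp [incl]
  have h2 : phi p (esymm (Fin p) ℤ (n + 1)) = _ := hr
  have h3 : ∀ j, aeval (fun l : Fin p => (X (Sum.inl l) ^ p : IntJet p))
      (pderiv j (esymm (Fin p) ℤ (n + 1))) =
      esymmAt (fun l => X (Sum.inl l) ^ p) (univ.erase j) n := by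
    intro j
    rw [pderiv_esymm, ← AlgHom.coe_toRingHom, map_esymmAt]
    simp only [AlgHom.coe_toRingHom, aeval_X]
  simp only [h3] at h2
  rw [p_mul_delta, h2, mul_add, mul_add, h1]
  ring

variable {p}

/-- The value of `δ S_{n+1}` in characteristic `p`. -/
theorem aeval_delta_esymm {Q : Type*} [CommRing Q] [CharP Q p] [Algebra ℤ Q]
    (x : Fin p → Q) (n : ℕ) :
    aeval (Sum.elim (fun j => C (x j)) fun j => X j) (delta p (esymm (Fin p) ℤ (n + 1))) =
      ∑ j, C (esymmAt x (univ.erase j) n ^ p) * X j +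
        C (aeval (fun l : Fin p => esymmAt x univ (l + 1)) (powDefect p (n + 1))) := by
  obtain ⟨r, hr⟩ := exists_delta_esymm p n
  have hp0 : (p : MvPolynomial (Fin p) Q) = 0 := CharP.cast_eq_zero _ p
  set f : IntJet p →ₐ[ℤ] MvPolynomial (Fin p) Q := aeval (Sum.elim (fun j => C (x j)) fun j => X j)
    with hf
  rw [hr, map_add, map_add, map_mul f (p : IntJet p), map_natCast, hp0, zero_mul, add_zero, map_sum]
  congr 1
  · refine sum_congr rfl fun j _ => ?_
    rw [map_mul, ← esymmAt_pow_char, map_esymmAt, ← AlgHom.coe_toRingHom, map_esymmAt]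
    simp [hf]
  · rw [← AlgHom.coe_toRingHom (incl p), map_aeval_int, ← AlgHom.coe_toRingHom f, map_aeval_int,
      map_aeval_int]
    congr 2
    funext l
    rw [esymm_eq_esymmAt, map_esymmAt, map_esymmAt, map_esymmAt]
    simp [hf, incl]

theorem exists_roots_of_X_pow {K : Type*} [Field K] [IsAlgClosed K] (hp2 : p ≠ 2) (y : K) :
    ∃ r : Fin p → K, (∀ l, r l ^ p = y) ∧
      ∀ l : Fin p, esymmAt r univ (l + 1) = if l = lastIdx p then y else 0 := by
  have hp := (Fact.out : p.Prime)
  set P : Polynomial K := Polynomial.X ^ p - Polynomial.C y with hP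
  have hmonic : P.Monic := Polynomial.monic_X_pow_sub_C y hp.ne_zero
  have hdeg : P.natDegree = p := Polynomial.natDegree_X_pow_sub_C
  have hsplit : P.Splits := IsAlgClosed.splits P
  have hcard : P.roots.card = p := by rw [← hsplit.natDegree_eq_card_roots, hdeg]
  have hlen : P.roots.toList.length = p := by rw [Multiset.length_toList, hcard]
  set r : Fin p → K := fun l => P.roots.toList.get (l.cast hlen.symm) with hr
  have hroots : univ.val.map r = P.roots := by
    have h : List.ofFn r = P.roots.toList := by
      apply List.ext_get
      · simp [hlen]
      · intro n h1 h2
        simp [hr]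
    rw [Fin.univ_val_map, h, Multiset.coe_toList]
  refine ⟨r, fun l => ?_, fun l => ?_⟩
  · have h : r l ∈ P.roots := by
      rw [← Multiset.mem_toList]
      exact List.get_mem _ _
    have h2 := (Polynomial.mem_roots'.mp h).2
    rw [Polynomial.IsRoot.def, hP] at h2
    simpa [sub_eq_zero] using h2
  · have hl : (l : ℕ) + 1 ≤ p := l.2
    -- Vieta's formula. Only the leading and constant coefficients of `X^p - y` are nonzero, and for
    -- odd `p` the product of the roots is `y`.
    have h := Polynomial.coeff_eq_esymm_roots_of_splits hsplit (k := p - (l + 1))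
      (by rw [hdeg]; exact Nat.sub_le _ _)
    rw [hmonic.leadingCoeff, one_mul, hdeg, Nat.sub_sub_self hl, ← hroots, esymm_map_val] at h
    change esymmAt r univ (l + 1) = _
    have h3 : P.coeff (p - (l + 1)) = (-1) ^ ((l : ℕ) + 1) * esymmAt r univ (l + 1) := h
    rw [hP, Polynomial.coeff_sub, Polynomial.coeff_X_pow, Polynomial.coeff_C,
      if_neg (by omega)] at h3
    by_cases hlast : l = lastIdx p
    · have hval : (l : ℕ) + 1 = p := by
        rw [hlast]
        exact Nat.sub_add_cancel hp.one_le
      rw [if_pos hlast]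
      rw [if_pos (by omega), hval, (hp.odd_of_ne_two hp2).neg_one_pow] at h3
      rw [hval]
      linear_combination h3
    · have hval : (l : ℕ) + 1 ≠ p := fun h => hlast (Fin.ext (by
        change (l : ℕ) = p - 1
        omega))
      rw [if_neg hlast]
      rw [if_neg (by omega), zero_sub, neg_zero] at h3
      exact (mul_eq_zero.mp h3.symm).resolve_left (pow_ne_zero _ (by simp))

/-- The point `(0, …, 0, y)` consists of the elementary symmetric functions of the roots of `X^p -
y`. The `p`-th powers of these roots all equal `y`, so the defining relation reads `p T_n = choose p
n * y^n - S_n^p`. It suffices to treat the universal `y = X` over `ℤ`, which embeds in an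
algebraically closed field where `p` can be cancelled. -/
theorem aeval_powDefect_lastIdx {A : Type*} [CommRing A] [Algebra ℤ A] (hp2 : p ≠ 2)
    (y : A) (i : Fin p) :
    aeval (fun l => if l = lastIdx p then y else 0) (powDefect p (i + 1)) =
      if i = lastIdx p then 0 else ((p.choose (i + 1) / p : ℕ) : A) * y ^ ((i : ℕ) + 1) := by
  have hp := (Fact.out : p.Prime)
  suffices h : aeval (fun l => if l = lastIdx p then (Polynomial.X : Polynomial ℤ) else 0)
      (powDefect p (i + 1)) = if i = lastIdx p then 0 else
        ((p.choose (i + 1) / p : ℕ) : Polynomial ℤ) * Polynomial.X ^ ((i : ℕ) + 1) by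
    have h2 := congrArg (Polynomial.eval₂RingHom (Int.castRingHom A) y) h
    rw [map_aeval_int] at h2
    simpa [apply_ite (Polynomial.eval₂ (Int.castRingHom A) y)] using h2
  let K := AlgebraicClosure (FractionRing (Polynomial ℤ))
  let f : Polynomial ℤ →+* K :=
    (algebraMap (FractionRing (Polynomial ℤ)) K).comp (algebraMap (Polynomial ℤ) _)
  have hf : Function.Injective f :=
    (algebraMap (FractionRing (Polynomial ℤ)) K).injective.comp (IsFractionRing.injective _ _)
  have hpK : (p : K) ≠ 0 := by
    rw [← map_natCast f, map_ne_zero_iff f hf]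
    exact Nat.cast_ne_zero.mpr hp.ne_zero
  apply hf
  obtain ⟨r, hr1, hr2⟩ := exists_roots_of_X_pow hp2 (f Polynomial.X)
  have h := congrArg (aeval r) (p_mul_aeval_powDefect p (i + 1))
  rw [map_mul, map_natCast, ← AlgHom.comp_apply, comp_aeval, map_sub, map_pow, aeval_esymm, hr2,
    expand, ← aeval_eq_bind₁, ← AlgHom.comp_apply, comp_aeval, aeval_esymm] at h
  simp only [aeval_esymm, hr2, map_pow, aeval_X, hr1] at h
  rw [esymmAt_const, Fintype.card_fin] at h
  have h4 : f (aeval (fun l => if l = lastIdx p then (Polynomial.X : Polynomial ℤ) else 0)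
      (powDefect p (i + 1))) =
      aeval (fun l => if l = lastIdx p then f Polynomial.X else 0) (powDefect p (i + 1)) := by
    rw [map_aeval_int]
    simp [apply_ite f]
  rw [h4]
  apply mul_left_cancel₀ hpK
  rw [h]
  by_cases hi : i = lastIdx p
  · have hval : (i : ℕ) + 1 = p := by
      rw [hi]
      exact Nat.sub_add_cancel hp.one_le
    simp [hi, ← hval]
  · have hval : (i : ℕ) + 1 < p := lt_of_le_of_ne i.2 fun h => hi (Fin.ext (by
      change (i : ℕ) = p - 1
      omega))
    have hd : p ∣ p.choose (i + 1) := hp.dvd_choose_self (Nat.succ_ne_zero _) hval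
    rw [if_neg hi, if_neg hi, zero_pow hp.ne_zero, sub_zero, map_mul, map_pow, map_natCast,
      ← mul_assoc, ← Nat.cast_mul, Nat.mul_div_cancel' hd]

end Delta

end

end DeltaSeries

namespace DeltaSeries

noncomputable section

open Finset

/-! ## Expansions in the basis of elementary symmetric functions -/

section Expansion

variable (p : ℕ) (k : Type*) [Field k]

/-- The element `s_n` of `k[[s_1, …, s_p]]`, where `s_0 = 1` and `s_n = 0` for `n > p`. -/
def elemVar : ℕ → MvPowerSeries (Fin p) k
  | 0 => 1
  | n + 1 => if h : n < p then MvPowerSeries.X ⟨n, h⟩ else 0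

theorem taylorCoeffHom_X (i : Fin p) :
    taylorCoeffHom p k (MvPowerSeries.X i) = esymmAt MvPowerSeries.X univ ((i : ℕ) + 1) := by
  change MvPowerSeries.substAlgHom (hasSubst_symmSeries p k) _ = _
  rw [MvPowerSeries.substAlgHom_X, symmSeries, esymm_eq_esymmAt,
    ← MvPolynomial.coeToMvPowerSeries.ringHom_apply, map_esymmAt]
  simp

theorem taylorCoeffHom_elemVar (n : ℕ) :
    taylorCoeffHom p k (elemVar p k n) = esymmAt MvPowerSeries.X univ n := by
  rcases n with - | n
  · rw [esymmAt_zero, elemVar, map_one]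
  · rw [elemVar]
    split_ifs with h
    · exact taylorCoeffHom_X p k ⟨n, h⟩
    · rw [map_zero, esymmAt_of_card_lt]
      rw [card_univ, Fintype.card_fin]
      omega

theorem taylorCoeffHom_C (a : k) :
    taylorCoeffHom p k (MvPowerSeries.C a) = MvPowerSeries.C a :=
  (MvPowerSeries.substAlgHom (R := k) (hasSubst_symmSeries p k)).commutes a

theorem taylorVar_X (j : Fin p) : taylorVar p k j PowerSeries.X = MvPowerSeries.X j := by
  change PowerSeries.substAlgHom (PowerSeries.HasSubst.X j) PowerSeries.X = _
  rw [PowerSeries.coe_substAlgHom, PowerSeries.subst_X (PowerSeries.HasSubst.X j)]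

theorem taylorVar_C (j : Fin p) (a : k) :
    taylorVar p k j (PowerSeries.C a) = MvPowerSeries.C a :=
  (PowerSeries.substAlgHom (R := k) (PowerSeries.HasSubst.X j : PowerSeries.HasSubst
      (MvPowerSeries.X j : MvPowerSeries (Fin p) k))).commutes a

/-- The inverse of `1 - s_1 + s_2 - ⋯`. Its part of weight `n` is the complete homogeneous symmetric
function of degree `n` as a polynomial in the elementary ones. -/
def completeSeries : MvPowerSeries (Fin p) k :=
  (1 - ∑ i : Fin p, (-1) ^ (i : ℕ) * MvPowerSeries.X i)⁻¹

theorem completeSeries_eq :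
    completeSeries p k =
      1 + ∑ i : Fin p, (-1) ^ (i : ℕ) * (MvPowerSeries.X i * completeSeries p k) := by
  have h : (1 - ∑ i : Fin p, (-1) ^ (i : ℕ) * MvPowerSeries.X i) * completeSeries p k = 1 := by
    apply MvPowerSeries.mul_inv_cancel
    simp
  rw [sub_mul, one_mul, sum_mul, sub_eq_iff_eq_add] at h
  simpa only [mul_assoc] using h

variable {p k}

/-- The weight of a monomial when `s_i` has weight `i`. -/
def wt (d : Fin p →₀ ℕ) : ℕ := ∑ i : Fin p, ((i : ℕ) + 1) * d i

theorem wt_add (d e : Fin p →₀ ℕ) : wt (d + e) = wt d + wt e := by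
  simp [wt, mul_add, sum_add_distrib]

theorem wt_single (i : Fin p) (n : ℕ) : wt (Finsupp.single i n) = (i + 1) * n := by
  rw [wt, sum_eq_single i]
  · simp
  · intro j _ hj
    rw [Finsupp.single_eq_of_ne hj, mul_zero]
  · simp

/-- The power series `∑ a_{m+n} q^m`. -/
def shift (n : ℕ) (χ : PowerSeries k) : PowerSeries k :=
  PowerSeries.mk fun m => PowerSeries.coeff (m + n) χ

theorem shift_zero (χ : PowerSeries k) : shift 0 χ = χ := by
  ext m
  simp [shift]

theorem shift_shift (m n : ℕ) (χ : PowerSeries k) : shift m (shift n χ) = shift (m + n) χ := by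
  ext l
  simp [shift, add_assoc]

theorem eq_X_mul_shift_add (χ : PowerSeries k) :
    χ = PowerSeries.X * shift 1 χ + PowerSeries.C (PowerSeries.coeff 0 χ) :=
by
  rw [PowerSeries.coeff_zero_eq_constantCoeff]
  exact PowerSeries.eq_X_mul_shift_add_const χ

variable (p) in
/-- The series `∑ a_n h_n`, where `h_n` is the complete homogeneous symmetric function of
degree `n` as a polynomial in the elementary ones. -/
def completeSum (χ : PowerSeries k) : MvPowerSeries (Fin p) k :=
  fun d => MvPowerSeries.coeff d (completeSeries p k) * PowerSeries.coeff (wt d) χ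

theorem coeff_completeSum (χ : PowerSeries k) (d : Fin p →₀ ℕ) :
    MvPowerSeries.coeff d (completeSum p χ) =
      MvPowerSeries.coeff d (completeSeries p k) * PowerSeries.coeff (wt d) χ := rfl

theorem coeff_neg_one_pow_mul_X_mul (i : Fin p) (f : MvPowerSeries (Fin p) k) (d : Fin p →₀ ℕ) :
    MvPowerSeries.coeff d ((-1) ^ (i : ℕ) * (MvPowerSeries.X i * f)) =
      if Finsupp.single i 1 ≤ d then
        (-1) ^ (i : ℕ) * MvPowerSeries.coeff (d - Finsupp.single i 1) f else 0 := by
  rw [show ((-1) ^ (i : ℕ) : MvPowerSeries (Fin p) k) = MvPowerSeries.C ((-1) ^ (i : ℕ)) by simp,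
    MvPowerSeries.coeff_C_mul, MvPowerSeries.X_def, MvPowerSeries.coeff_monomial_mul]
  split_ifs <;> simp

/-- The recursion `h_n = s_1 h_{n-1} - s_2 h_{n-2} + ⋯`, read off coefficientwise from
`completeSeries_eq`: removing one `s_{i+1}` lowers the weight by `i + 1`, which the shift of `χ`
compensates. -/
theorem completeSum_eq (χ : PowerSeries k) :
    completeSum p χ = MvPowerSeries.C (PowerSeries.coeff 0 χ) +
      ∑ i : Fin p, (-1) ^ (i : ℕ) * (MvPowerSeries.X i * completeSum p (shift (i + 1) χ)) := by
  classical
  ext d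
  rw [coeff_completeSum, completeSeries_eq, map_add, map_add, map_sum, map_sum, add_mul, sum_mul]
  congr 1
  · rw [MvPowerSeries.coeff_one, MvPowerSeries.coeff_C]
    split_ifs with h
    · simp [h, wt]
    · simp
  · refine sum_congr rfl fun i _ => ?_
    rw [coeff_neg_one_pow_mul_X_mul, coeff_neg_one_pow_mul_X_mul, coeff_completeSum]
    split_ifs with h
    · have hw : wt (d - Finsupp.single i 1) + ((i : ℕ) + 1) = wt d := by
        conv_rhs => rw [← tsub_add_cancel_of_le h, wt_add, wt_single, mul_one]
      rw [shift, PowerSeries.coeff_mk, hw]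
      ring
    · rw [zero_mul]

variable (p) in
/-- The coefficients of `χ(q_j)` in the basis given by the derivatives of the elementary symmetric
functions with respect to `q_j`. -/
def expCoeff (χ : PowerSeries k) (i : ℕ) : MvPowerSeries (Fin p) k :=
  (-1) ^ i * completeSum p (shift i χ)

theorem expCoeff_succ (χ : PowerSeries k) (i : ℕ) :
    expCoeff p χ (i + 1) = -expCoeff p (shift 1 χ) i := by
  rw [expCoeff, expCoeff, shift_shift, pow_succ]
  ring

theorem expCoeff_zero (χ : PowerSeries k) :
    expCoeff p χ 0 = MvPowerSeries.C (PowerSeries.coeff 0 χ) +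
      ∑ i ∈ range p, elemVar p k (i + 1) * expCoeff p (shift 1 χ) i := by
  rw [expCoeff, shift_zero, pow_zero, one_mul, completeSum_eq, sum_range]
  congr 1
  refine sum_congr rfl fun i _ => ?_
  rw [elemVar, dif_pos i.2, expCoeff, shift_shift]
  ring

/-- The error of the expansion of `χ` is `q_j` times the error for the shifted series. Iterating
this makes the error divisible by every power of `q_j`, hence zero. -/
theorem taylorVar_sub_expansion (χ : PowerSeries k) (j : Fin p) :
    taylorVar p k j χ - ∑ i ∈ range p, taylorCoeffHom p k (expCoeff p χ i) *
        esymmAt MvPowerSeries.X (univ.erase j) i =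
      MvPowerSeries.X j * (taylorVar p k j (shift 1 χ) -
        ∑ i ∈ range p, taylorCoeffHom p k (expCoeff p (shift 1 χ) i) *
          esymmAt MvPowerSeries.X (univ.erase j) i) := by
  set E := fun i => esymmAt (MvPowerSeries.X : Fin p → MvPowerSeries (Fin p) k) (univ.erase j) i
  have hE : ∀ i, MvPowerSeries.X j * E i = esymmAt MvPowerSeries.X univ (i + 1) - E (i + 1) :=
    fun i => eq_sub_of_add_eq' (esymmAt_erase MvPowerSeries.X (mem_univ j) i)
  have h0 : E 0 = 1 := esymmAt_zero _ _
  -- Only `p - 1` variables remain after omitting `q_j`. Adding this zero term lets the sum over `i`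
  -- be reindexed by `i + 1`.
  have hp : E p = 0 := by
    apply esymmAt_of_card_lt
    rw [card_erase_of_mem (mem_univ j), card_univ, Fintype.card_fin]
    exact Nat.sub_lt (Fin.pos j) Nat.one_pos
  have h1 : ∑ i ∈ range p, taylorCoeffHom p k (expCoeff p χ i) * E i =
      ∑ i ∈ range p, taylorCoeffHom p k (expCoeff p χ (i + 1)) * E (i + 1) +
        taylorCoeffHom p k (expCoeff p χ 0) := by
    have h := sum_range_succ (fun i => taylorCoeffHom p k (expCoeff p χ i) * E i) p
    rw [sum_range_succ', hp, h0, mul_zero, add_zero, mul_one] at h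
    exact h.symm
  have h2 : MvPowerSeries.X j * ∑ i ∈ range p,
      taylorCoeffHom p k (expCoeff p (shift 1 χ) i) * E i =
      ∑ i ∈ range p, taylorCoeffHom p k (elemVar p k (i + 1) * expCoeff p (shift 1 χ) i) +
        ∑ i ∈ range p, taylorCoeffHom p k (expCoeff p χ (i + 1)) * E (i + 1) := by
    rw [mul_sum, ← sum_add_distrib]
    refine sum_congr rfl fun i _ => ?_
    rw [map_mul, taylorCoeffHom_elemVar, expCoeff_succ, map_neg]
    linear_combination taylorCoeffHom p k (expCoeff p (shift 1 χ) i) * hE i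
  rw [mul_sub, h1, h2, expCoeff_zero, map_add, map_sum, taylorCoeffHom_C]
  conv_lhs => rw [eq_X_mul_shift_add χ]
  rw [map_add, map_mul, taylorVar_X, taylorVar_C]
  conv_lhs => rw [← eq_X_mul_shift_add χ]
  ring

theorem eq_zero_of_forall_X_pow_dvd {j : Fin p} {f : MvPowerSeries (Fin p) k}
    (h : ∀ n, (MvPowerSeries.X j) ^ n ∣ f) : f = 0 := by
  ext d
  rw [map_zero]
  exact MvPowerSeries.X_pow_dvd_iff.mp (h (d j + 1)) d (Nat.lt_succ_self _)

theorem taylorVar_eq_expansion (χ : PowerSeries k) (j : Fin p) :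
    taylorVar p k j χ = ∑ i ∈ range p, taylorCoeffHom p k (expCoeff p χ i) *
      esymmAt MvPowerSeries.X (univ.erase j) i := by
  rw [← sub_eq_zero]
  apply eq_zero_of_forall_X_pow_dvd (j := j)
  intro n
  induction n generalizing χ with
  | zero => simp
  | succ n ih =>
    rw [taylorVar_sub_expansion, pow_succ']
    exact mul_dvd_mul_left _ (ih _)

/-! ### Specialization of the expansion coefficients at `(0, …, 0, q)`. -/

variable [Fact p.Prime]

variable (p k) in
/-- `k[[s_1, …, s_p]] → k[[q]]`, `(s_1, …, s_{p-1}, s_p) ↦ (0, …, 0, q)`. -/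
def taylorSpecCoeff : MvPowerSeries (Fin p) k →ₐ[k] PowerSeries k :=
  MvPowerSeries.substAlgHom (R := k) (hasSubst_spec p k)

theorem taylorSpecCoeff_X (i : Fin p) :
    taylorSpecCoeff p k (MvPowerSeries.X i) = if i = lastIdx p then PowerSeries.X else 0 :=
  MvPowerSeries.substAlgHom_X _ _

theorem lastIdx_val_add_one : ((lastIdx p : Fin p) : ℕ) + 1 = p :=
  Nat.sub_add_cancel (Fact.out : p.Prime).one_le

/-- Only the `s_p` term of the recursion `completeSum_eq` survives. Its sign is `(-1)^(p-1) = 1`,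
and it shifts `χ` by `p` at the cost of one factor `q`. -/
theorem coeff_taylorSpecCoeff_completeSum (hp2 : p ≠ 2) (r : ℕ) (χ : PowerSeries k) :
    PowerSeries.coeff r (taylorSpecCoeff p k (completeSum p χ)) = PowerSeries.coeff (p * r) χ := by
  have heven : Even ((lastIdx p : Fin p) : ℕ) :=
    (Fact.out : p.Prime).even_sub_one hp2
  have h (χ : PowerSeries k) : taylorSpecCoeff p k (completeSum p χ) =
      PowerSeries.C (PowerSeries.coeff 0 χ) + PowerSeries.X * taylorSpecCoeff p k (completeSum p (shift p χ)) := by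
    rw [completeSum_eq, map_add, map_sum, sum_eq_single (lastIdx p)]
    · rw [heven.neg_one_pow, one_mul, map_mul, taylorSpecCoeff_X, if_pos rfl, lastIdx_val_add_one]
      congr 1
      exact (taylorSpecCoeff p k).commutes _
    · intro i _ hi
      rw [map_mul, map_mul, taylorSpecCoeff_X, if_neg hi, zero_mul, mul_zero]
    · simp
  induction r generalizing χ with
  | zero => rw [h]; simp
  | succ r ih =>
    rw [h, map_add, PowerSeries.coeff_succ_X_mul, ih, shift, PowerSeries.coeff_mk,
      PowerSeries.coeff_C, if_neg (Nat.succ_ne_zero r), zero_add, mul_add, mul_one]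

theorem coeff_taylorSpecCoeff_expCoeff (hp2 : p ≠ 2) (r i : ℕ) (χ : PowerSeries k) :
    PowerSeries.coeff r (taylorSpecCoeff p k (expCoeff p χ i)) =
      (-1) ^ i * PowerSeries.coeff (p * r + i) χ := by
  rw [expCoeff, map_mul, map_pow, map_neg, map_one,
    show ((-1) ^ i : PowerSeries k) = PowerSeries.C ((-1) ^ i) by simp, PowerSeries.coeff_C_mul,
    coeff_taylorSpecCoeff_completeSum hp2, shift, PowerSeries.coeff_mk]

end Expansion

/-! ### Expansions of Laurent series. -/

section LaurentExpansion

variable {p : ℕ} {k : Type*} [Field k]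

variable (p k) in
/-- The element `q_l` of `k[[q_1, …, q_p]][(q_1 ⋯ q_p)⁻¹]`. -/
def laurentX (l : Fin p) : LaurentQ p k :=
  algebraMap (MvPowerSeries (Fin p) k) (LaurentQ p k) (MvPowerSeries.X l)

theorem laurentVar_algebraMap (j : Fin p) (χ : PowerSeries k) :
    laurentVar p k j (algebraMap (PowerSeries k) (LaurentSeries k) χ) =
      algebraMap _ (LaurentQ p k) (taylorVar p k j χ) :=
  IsLocalization.Away.lift_eq _ _ _

theorem algebraMap_esymmAt (s : Finset (Fin p)) (n : ℕ) :
    algebraMap (MvPowerSeries (Fin p) k) (LaurentQ p k) (esymmAt MvPowerSeries.X s n) =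
      esymmAt (laurentX p k) s n :=
  map_esymmAt _ _ _ _

theorem laurentVar_single_neg_one_mul (j : Fin p) :
    laurentX p k j * laurentVar p k j (HahnSeries.single (-1) 1) = 1 := by
  rw [laurentX, ← taylorVar_X, ← laurentVar_algebraMap, ← map_mul, LaurentSeries.coe_algebraMap,
    HahnSeries.ofPowerSeries_X, HahnSeries.single_mul_single]
  simp

variable [Fact p.Prime]

theorem laurentCoeffHom_algebraMap (f : MvPowerSeries (Fin p) k) :
    laurentCoeffHom p k (algebraMap _ (LaurentS p k) f) =
      algebraMap _ (LaurentQ p k) (taylorCoeffHom p k f) :=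
  IsLocalization.Away.lift_eq _ _ _

theorem laurentSpecCoeff_algebraMap (f : MvPowerSeries (Fin p) k) :
    laurentSpecCoeff p k (algebraMap _ (LaurentS p k) f) =
      algebraMap _ (LaurentSeries k) (taylorSpecCoeff p k f) :=
  IsLocalization.Away.lift_eq _ _ _

theorem laurentCoeffHom_elemVar (n : ℕ) :
    laurentCoeffHom p k (algebraMap _ (LaurentS p k) (elemVar p k n)) =
      esymmAt (laurentX p k) univ n := by
  rw [laurentCoeffHom_algebraMap, taylorCoeffHom_elemVar, algebraMap_esymmAt]

theorem taylorSpecCoeff_elemVar (n : ℕ) :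
    taylorSpecCoeff p k (elemVar p k n) =
      if n = 0 then 1 else if n = p then PowerSeries.X else 0 := by
  rcases n with - | n
  · rw [elemVar, map_one, if_pos rfl]
  · rw [elemVar, if_neg (Nat.succ_ne_zero n)]
    split_ifs with h1 h2 h2
    · rw [taylorSpecCoeff_X, if_pos]
      exact Fin.ext (by have := lastIdx_val_add_one (p := p); simp only; omega)
    · rw [taylorSpecCoeff_X, if_neg]
      intro h
      apply h2
      have := congrArg Fin.val h
      have := lastIdx_val_add_one (p := p)
      simp only at *
      omega
    · omega
    · rw [map_zero]

theorem elemVar_self : elemVar p k p = MvPowerSeries.X (lastIdx p) := by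
  have h : elemVar p k ((lastIdx p : ℕ) + 1) = MvPowerSeries.X (lastIdx p) := by
    rw [elemVar, dif_pos (lastIdx p).2]
  rwa [lastIdx_val_add_one] at h

/-- The `c i` are coefficients of `χ(q_j)` in the basis given by the derivatives of the elementary
symmetric functions with respect to `q_j`, with specializations determined by `χ`. -/
def IsExpansion (χ : LaurentSeries k) (c : ℕ → LaurentS p k) : Prop :=
  (∀ j, laurentVar p k j χ =
    ∑ i ∈ range p, laurentCoeffHom p k (c i) * esymmAt (laurentX p k) (univ.erase j) i) ∧
  ∀ i < p, ∀ r : ℤ, (laurentSpecCoeff p k (c i)).coeff r = (-1) ^ i * χ.coeff (p * r + i)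

theorem isExpansion_algebraMap (hp2 : p ≠ 2) (χ : PowerSeries k) :
    IsExpansion (algebraMap _ (LaurentSeries k) χ)
      fun i => algebraMap _ (LaurentS p k) (expCoeff p χ i) := by
  constructor
  · intro j
    rw [laurentVar_algebraMap, taylorVar_eq_expansion, map_sum]
    refine sum_congr rfl fun i _ => ?_
    rw [map_mul, laurentCoeffHom_algebraMap, algebraMap_esymmAt]
  · intro i hi r
    rw [laurentSpecCoeff_algebraMap, LaurentSeries.coe_algebraMap]
    rcases lt_or_ge r 0 with hr | hr
    · rw [PowerSeries.coeff_coe, PowerSeries.coeff_coe, if_pos hr, if_pos (by nlinarith), mul_zero]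
    · lift r to ℕ using hr
      rw [show (p : ℤ) * r + i = ((p * r + i : ℕ) : ℤ) by push_cast; ring,
        LaurentSeries.coeff_coe_powerSeries, LaurentSeries.coeff_coe_powerSeries,
        coeff_taylorSpecCoeff_expCoeff hp2]

/-- Dividing by `q_j`: one has `q_j⁻¹ e_{i+1}(ĵ) = q_j⁻¹ s_{i+1} - e_i(ĵ)` and `q_j⁻¹ = s_p⁻¹
e_{p-1}(ĵ)`. So the coefficients move down by one index with a sign, and all the terms in `q_j⁻¹`
collect in the top coefficient. -/
theorem IsExpansion.single_neg_one_mul (hp2 : p ≠ 2) {χ : LaurentSeries k} {c : ℕ → LaurentS p k}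
    (h : IsExpansion χ c) :
    IsExpansion (HahnSeries.single (-1) 1 * χ) (fun i => if i + 1 = p then
      IsLocalization.Away.invSelf (MvPowerSeries.X (lastIdx p) : MvPowerSeries (Fin p) k) *
        ∑ i ∈ range p, algebraMap _ (LaurentS p k) (elemVar p k i) * c i
      else -c (i + 1)) := by
  have hp := (Fact.out : p.Prime)
  obtain ⟨m, hm⟩ : ∃ m, p = m + 1 := ⟨p - 1, (Nat.sub_add_cancel hp.one_le).symm⟩
  have hrange : range p = range (m + 1) := congrArg range hm
  have hinv : algebraMap (MvPowerSeries (Fin p) k) (LaurentS p k) (elemVar p k p) *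
      IsLocalization.Away.invSelf (MvPowerSeries.X (lastIdx p) : MvPowerSeries (Fin p) k) = 1 := by
    rw [elemVar_self]
    exact IsLocalization.Away.mul_invSelf _
  set w : LaurentS p k := IsLocalization.Away.invSelf
    (MvPowerSeries.X (lastIdx p) : MvPowerSeries (Fin p) k) with hw
  constructor
  · intro j
    have hE : ∀ i, laurentX p k j * esymmAt (laurentX p k) (univ.erase j) i =
        esymmAt (laurentX p k) univ (i + 1) - esymmAt (laurentX p k) (univ.erase j) (i + 1) :=
      fun i => eq_sub_of_add_eq' (esymmAt_erase (laurentX p k) (mem_univ j) i)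
    have hEp : esymmAt (laurentX p k) (univ.erase j) p = 0 := by
      apply esymmAt_of_card_lt
      rw [card_erase_of_mem (mem_univ j), card_univ, Fintype.card_fin]
      exact Nat.sub_lt (Fin.pos j) Nat.one_pos
    have hlast := hE m
    rw [show m + 1 = p from hm.symm, hEp, sub_zero, ← laurentCoeffHom_elemVar] at hlast
    have hinv' := congrArg (laurentCoeffHom p k) hinv
    rw [map_mul, map_one] at hinv'
    apply (IsUnit.of_mul_eq_one _ (laurentVar_single_neg_one_mul (k := k) j)).mul_left_cancel
    rw [map_mul, ← mul_assoc, laurentVar_single_neg_one_mul, one_mul, h.1 j, hrange,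
      sum_range_succ' _ m, sum_range_succ _ m]
    beta_reduce
    rw [if_pos hm.symm, mul_add, mul_sum]
    have h1 : ∀ i ∈ range m, laurentX p k j * (laurentCoeffHom p k
        (if i + 1 = p then w * ∑ i ∈ range (m + 1),
          algebraMap _ (LaurentS p k) (elemVar p k i) * c i
      else -c (i + 1)) *
        esymmAt (laurentX p k) (univ.erase j) i) =
        laurentCoeffHom p k (c (i + 1)) * esymmAt (laurentX p k) (univ.erase j) (i + 1) -
        laurentCoeffHom p k (c (i + 1)) * esymmAt (laurentX p k) univ (i + 1) := by
      intro i hi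
      rw [if_neg (by have := mem_range.mp hi; omega), map_neg]
      linear_combination (-laurentCoeffHom p k (c (i + 1))) * hE i
    rw [sum_congr rfl h1, sum_sub_distrib, map_mul, map_sum, sum_range_succ']
    simp only [map_mul, laurentCoeffHom_elemVar, esymmAt_zero] at hlast hinv' ⊢
    rw [sum_congr rfl fun i _ => mul_comm (esymmAt (laurentX p k) univ (i + 1)) _]
    set A := ∑ i ∈ range m, laurentCoeffHom p k (c (i + 1)) * esymmAt (laurentX p k) univ (i + 1)
    linear_combination (-(A + laurentCoeffHom p k (c 0)) * laurentCoeffHom p k w) * hlast -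
      (A + laurentCoeffHom p k (c 0)) * hinv'
  · intro i hi r
    have hs : (HahnSeries.single (-1 : ℤ) (1 : k) * χ).coeff (p * r + i) =
        χ.coeff (p * r + (i + 1)) := by
      have := HahnSeries.coeff_single_mul_add (r := (1 : k)) (x := χ) (a := p * r + (i + 1))
        (b := -1)
      rw [one_mul] at this
      rw [← this]
      congr 1
      ring
    rw [hs]
    beta_reduce
    split_ifs with hip
    · have hX : laurentSpecCoeff p k w = HahnSeries.single (-1) 1 := by
        have h2 := congrArg (laurentSpecCoeff p k) hinv
        rw [map_mul, map_one, laurentSpecCoeff_algebraMap, taylorSpecCoeff_elemVar,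
          if_neg hp.ne_zero, if_pos rfl, LaurentSeries.coe_algebraMap,
          HahnSeries.ofPowerSeries_X] at h2
        have h3 : (HahnSeries.single (1 : ℤ) (1 : k)) * HahnSeries.single (-1) 1 = 1 := by
          rw [HahnSeries.single_mul_single]
          simp
        exact (IsUnit.of_mul_eq_one _ h3).mul_left_cancel (h2.trans h3.symm)
      -- After specialization `s_1, …, s_{p-1}` vanish and `s_0 = 1`, so only `c 0` remains.
      have hsum : laurentSpecCoeff p k (∑ i ∈ range p,
          algebraMap (MvPowerSeries (Fin p) k) (LaurentS p k) (elemVar p k i) * c i) =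
          laurentSpecCoeff p k (c 0) := by
        rw [map_sum, sum_eq_single 0]
        · rw [elemVar, map_one, one_mul]
        · intro n hn hn0
          rw [map_mul, laurentSpecCoeff_algebraMap, taylorSpecCoeff_elemVar, if_neg hn0,
            if_neg (mem_range.mp hn).ne, map_zero, zero_mul]
        · intro h0
          exact absurd (mem_range.mpr hp.pos) h0
      rw [map_mul, hX, hsum]
      have := HahnSeries.coeff_single_mul_add (r := (1 : k)) (x := laurentSpecCoeff p k (c 0))
        (a := r + 1) (b := -1)
      rw [add_neg_cancel_right, one_mul, h.2 0 hp.pos] at this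
      have heven : Even i := by
        rw [show i = p - 1 by omega]
        exact hp.even_sub_one hp2
      have hpi : (p : ℤ) = i + 1 := by rw [← hip]; push_cast; ring
      rw [this, heven.neg_one_pow, pow_zero, one_mul, one_mul]
      congr 1
      push_cast
      linear_combination hpi
    · rw [map_neg, HahnSeries.coeff_neg, h.2 (i + 1) (by omega)]
      push_cast
      ring

theorem exists_isExpansion (hp2 : p ≠ 2) (χ : LaurentSeries k) :
    ∃ c : ℕ → LaurentS p k, IsExpansion χ c := by
  obtain ⟨n, a, ha⟩ := IsLocalization.Away.surj (PowerSeries.X : PowerSeries k) χ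
  induction n generalizing χ with
  | zero =>
    rw [pow_zero, mul_one] at ha
    exact ⟨_, ha ▸ isExpansion_algebraMap hp2 a⟩
  | succ n ih =>
    rw [pow_succ', ← mul_assoc] at ha
    -- The induction hypothesis is applied to `χ * q`; dividing by `q` afterwards returns to `χ`.
    obtain ⟨c, hc⟩ := ih _ ha
    have h := IsExpansion.single_neg_one_mul hp2 hc
    rw [LaurentSeries.coe_algebraMap, HahnSeries.ofPowerSeries_X, mul_comm χ, ← mul_assoc,
      HahnSeries.single_mul_single] at h
    simp only [neg_add_cancel, mul_one, HahnSeries.single_zero_one, one_mul] at h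
    exact ⟨_, h⟩

end LaurentExpansion

/-! ## Injectivity -/

section Injectivity

variable {p : ℕ} {k : Type*} [Field k]

theorem finite_wt_eq (w : ℕ) : {d : Fin p →₀ ℕ | wt d = w}.Finite := by
  refine (Finsupp.finite_of_degree_le w).subset fun d hd => ?_
  rw [Set.mem_ofPred_eq] at hd ⊢
  rw [← hd, wt, Finsupp.degree_eq_sum]
  exact sum_le_sum fun i _ => Nat.le_mul_of_pos_left _ (Nat.succ_pos _)

theorem isHomogeneous_prod_esymm (d : Fin p →₀ ℕ) :
    (d.prod fun i n => MvPolynomial.esymm (Fin p) k ((i : ℕ) + 1) ^ n).IsHomogeneous (wt d) := by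
  rw [Finsupp.prod_fintype _ _ fun _ => pow_zero _]
  refine MvPolynomial.IsHomogeneous.prod _ _ _ fun i _ => ?_
  refine MvPolynomial.IsHomogeneous.pow ?_ _
  refine MvPolynomial.IsHomogeneous.sum _ _ _ fun t ht => ?_
  have h := MvPolynomial.IsHomogeneous.prod t (fun l => (MvPolynomial.X l : MvPolynomial (Fin p) k))
    (fun _ => 1) fun l _ => MvPolynomial.isHomogeneous_X k l
  rwa [sum_const, (mem_powersetCard.mp ht).2, smul_eq_mul, mul_one] at h

/-- Substituting `S_i` turns weight into degree, so each weight component of a series in the kernel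
is itself killed. Such a component is a polynomial, since there are finitely many monomials of given
weight, and the elementary symmetric polynomials are algebraically independent. -/
theorem taylorCoeffHom_injective : Function.Injective (taylorCoeffHom p k) := by
  rw [injective_iff_map_eq_zero]
  intro f hf
  set S : Fin p → MvPolynomial (Fin p) k := fun i => MvPolynomial.esymm (Fin p) k ((i : ℕ) + 1)
    with hS
  have key : ∀ w, ∑ d ∈ (finite_wt_eq (p := p) w).toFinset,
      MvPolynomial.monomial d (MvPowerSeries.coeff d f) = 0 := by
    intro w
    apply MvPolynomial.esymmAlgHom_fin_injective k (le_refl p)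
    apply Subtype.ext
    rw [MvPolynomial.esymmAlgHom_apply, map_zero, map_sum]
    change _ = (0 : MvPolynomial (Fin p) k)
    have hmon : ∀ d : Fin p →₀ ℕ, MvPolynomial.aeval S
        (MvPolynomial.monomial d (MvPowerSeries.coeff d f)) =
        MvPolynomial.C (MvPowerSeries.coeff d f) * d.prod fun i n => S i ^ n :=
      fun d => MvPolynomial.aeval_monomial _ _ _
    rw [sum_congr rfl fun d _ => hmon d]
    ext e
    rw [MvPolynomial.coeff_sum, MvPolynomial.coeff_zero]
    by_cases he : e.degree = w
    · have h : MvPowerSeries.coeff e (MvPowerSeries.subst (symmSeries p k) f) = 0 := by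
        rw [← MvPowerSeries.coe_substAlgHom (hasSubst_symmSeries p k)]
        change MvPowerSeries.coeff e (taylorCoeffHom p k f) = 0
        rw [hf, map_zero]
      rw [MvPowerSeries.coeff_subst (hasSubst_symmSeries p k)] at h
      have hcoe : ∀ d : Fin p →₀ ℕ, MvPowerSeries.coeff e (d.prod fun s n => symmSeries p k s ^ n) =
          MvPolynomial.coeff e (d.prod fun i n => S i ^ n) := by
        intro d
        have h2 := map_finsuppProd (MvPolynomial.coeToMvPowerSeries.ringHom (R := k)) d
          fun i n => S i ^ n
        rw [MvPolynomial.coeToMvPowerSeries.ringHom_apply] at h2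
        rw [← MvPolynomial.coeff_coe, h2]
        simp only [map_pow, MvPolynomial.coeToMvPowerSeries.ringHom_apply]
        rfl
      rw [finsum_eq_sum_of_support_subset (s := (finite_wt_eq (p := p) w).toFinset)] at h
      · rw [← h]
        refine sum_congr rfl fun d _ => ?_
        rw [MvPolynomial.coeff_C_mul, hcoe, smul_eq_mul]
      · intro d hd
        rw [Set.Finite.coe_toFinset, Set.mem_ofPred_eq]
        by_contra hne
        apply hd
        beta_reduce
        rw [hcoe, (isHomogeneous_prod_esymm d).coeff_eq_zero (by rw [he]; exact Ne.symm hne),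
          smul_zero]
    · refine sum_eq_zero fun d hd => ?_
      rw [Set.Finite.mem_toFinset, Set.mem_ofPred_eq] at hd
      rw [MvPolynomial.coeff_C_mul,
        (isHomogeneous_prod_esymm d).coeff_eq_zero (by rw [hd]; exact he), mul_zero]
  ext d
  have h := congrArg (MvPolynomial.coeff d) (key (wt d))
  rw [MvPolynomial.coeff_sum, sum_eq_single d] at h
  · simpa using h
  · intro e _ hed
    rw [MvPolynomial.coeff_monomial, if_neg hed]
  · intro hd
    exact absurd ((finite_wt_eq (wt d)).mem_toFinset.mpr rfl) hd

/-- For a kernel vector `v`, the recursion `esymmAt_erase` raised to the power `p` successively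
trades `e_n(ĵ)^p` for powers of `x_j^p`, until `∑ x_j^{pm} v_j = 0` for all `m < p`. The `x_j^p` are
distinct, so Vandermonde gives `v = 0`. -/
theorem det_esymmAt_pow_ne_zero {F : Type*} [CommRing F] [IsDomain F] [Fact p.Prime] [CharP F p]
    {x : Fin p → F} (hx : Function.Injective x) :
    (Matrix.of fun i j : Fin p => esymmAt x (univ.erase j) i ^ p).det ≠ 0 := by
  intro hdet
  obtain ⟨v, hv, hMv⟩ := Matrix.exists_mulVec_eq_zero_iff.mpr hdet
  have key : ∀ m n : ℕ, m ≤ n → n < p →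
      ∑ j, (x j ^ p) ^ m * esymmAt x (univ.erase j) (n - m) ^ p * v j = 0 := by
    intro m
    induction m with
    | zero =>
      intro n _ hn
      have h := congrFun hMv ⟨n, hn⟩
      simpa [Matrix.mulVec, dotProduct] using h
    | succ m ih =>
      intro n hmn hn
      have h1 := ih n (by omega) hn
      have h2 := ih m le_rfl (by omega)
      have h3 : ∀ j, x j ^ p * esymmAt x (univ.erase j) (n - (m + 1)) ^ p =
          esymmAt x univ (n - m) ^ p - esymmAt x (univ.erase j) (n - m) ^ p := by
        intro j
        have h := congrArg (frobenius F p) (esymmAt_erase x (mem_univ j) (n - (m + 1)))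
        rw [map_add, map_mul, show n - (m + 1) + 1 = n - m by omega] at h
        exact eq_sub_of_add_eq' h
      have h4 : ∀ j, (x j ^ p) ^ (m + 1) * esymmAt x (univ.erase j) (n - (m + 1)) ^ p * v j =
          esymmAt x univ (n - m) ^ p *
            ((x j ^ p) ^ m * esymmAt x (univ.erase j) (m - m) ^ p * v j) -
          (x j ^ p) ^ m * esymmAt x (univ.erase j) (n - m) ^ p * v j := by
        intro j
        rw [Nat.sub_self, esymmAt_zero, one_pow]
        linear_combination ((x j ^ p) ^ m * v j) * h3 j
      rw [sum_congr rfl fun j _ => h4 j, sum_sub_distrib, ← mul_sum, h1, h2, mul_zero, sub_zero]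
  apply hv
  refine Matrix.eq_zero_of_forall_pow_sum_mul_pow_eq_zero (f := fun j => x j ^ p)
    ((frobenius_inj F p).comp hx) fun m => ?_
  have h := key m m le_rfl m.2
  simp only [Nat.sub_self, esymmAt_zero, one_pow, mul_one] at h
  rw [← h]
  exact sum_congr rfl fun j _ => mul_comm _ _

/-- The images of the variables are affine linear in the `q_j'` with invertible matrix over the
fraction field. Undoing this change of variables leaves only the injective map on coefficients. -/
theorem eval₂Hom_injective {R Q : Type*} [CommRing R] [CommRing Q] [IsDomain Q] [Fact p.Prime]
    [CharP Q p] {τ : R →+* Q} (hτ : Function.Injective τ) {x : Fin p → Q}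
    (hx : Function.Injective x) {D : Fin p → MvPolynomial (Fin p) Q} {t : Fin p → Q}
    (hD : ∀ i : Fin p, D i = ∑ j, MvPolynomial.C (esymmAt x (univ.erase j) i ^ p) *
      MvPolynomial.X j + MvPolynomial.C (t i)) :
    Function.Injective (MvPolynomial.eval₂Hom (MvPolynomial.C.comp τ) D) := by
  let K := FractionRing Q
  let ι := algebraMap Q K
  have hι : Function.Injective ι := IsFractionRing.injective Q K
  let M : Matrix (Fin p) (Fin p) K :=
    (Matrix.of fun i j : Fin p => esymmAt x (univ.erase j) i ^ p).map ι
  have hM : IsUnit M.det := by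
    have h : M.det = ι (Matrix.of fun i j : Fin p => esymmAt x (univ.erase j) i ^ p).det :=
      (RingHom.map_det ι _).symm
    rw [h, isUnit_iff_ne_zero, map_ne_zero_iff ι hι]
    exact det_esymmAt_pow_ne_zero hx
  let ψ : MvPolynomial (Fin p) Q →+* MvPolynomial (Fin p) K :=
    MvPolynomial.eval₂Hom (MvPolynomial.C.comp ι) fun j =>
      ∑ i, MvPolynomial.C (M⁻¹ j i) * (MvPolynomial.X i - MvPolynomial.C (ι (t i)))
  have hψ : ψ.comp (MvPolynomial.eval₂Hom (MvPolynomial.C.comp τ) D) =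
      MvPolynomial.map (ι.comp τ) := by
    apply MvPolynomial.ringHom_ext
    · intro r
      simp [ψ]
    · intro i
      have h1 : ∀ l, ∑ j, M i j * M⁻¹ j l = (1 : Matrix (Fin p) (Fin p) K) i l := fun l => by
        rw [← Matrix.mul_nonsing_inv M hM, Matrix.mul_apply]
      have h2 : ∑ j, MvPolynomial.C (M i j) *
          ∑ l, MvPolynomial.C (M⁻¹ j l) * (MvPolynomial.X l - MvPolynomial.C (ι (t l))) =
          (MvPolynomial.X i - MvPolynomial.C (ι (t i)) : MvPolynomial (Fin p) K) := by
        simp only [mul_sum, ← mul_assoc, ← MvPolynomial.C_mul]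
        rw [sum_comm]
        simp only [← sum_mul, ← map_sum, h1, Matrix.one_apply]
        simp
      rw [RingHom.comp_apply, MvPolynomial.eval₂Hom_X', hD, map_add, map_sum, MvPolynomial.map_X]
      have h3 : ∀ j, ψ (MvPolynomial.C (esymmAt x (univ.erase j) i ^ p) * MvPolynomial.X j) =
          MvPolynomial.C (M i j) *
          ∑ l, MvPolynomial.C (M⁻¹ j l) * (MvPolynomial.X l - MvPolynomial.C (ι (t l))) := by
        intro j
        rw [map_mul, MvPolynomial.eval₂Hom_X', MvPolynomial.eval₂Hom_C]
        rfl
      rw [sum_congr rfl fun j _ => h3 j, h2, MvPolynomial.eval₂Hom_C]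
      simp
  have hinj : Function.Injective (ψ.comp (MvPolynomial.eval₂Hom (MvPolynomial.C.comp τ) D)) := by
    rw [hψ]
    exact MvPolynomial.map_injective _ (hι.comp hτ)
  exact Function.Injective.of_comp (f := ψ) hinj

theorem X_injective : Function.Injective (MvPowerSeries.X : Fin p → MvPowerSeries (Fin p) k) :=
  fun _ _ h => (MvPowerSeries.X_inj).mp h

instance : IsDomain (MvPowerSeries (Fin p) k) := NoZeroDivisors.to_isDomain _

theorem powers_prod_X_le : Submonoid.powers (∏ i : Fin p, MvPowerSeries.X i) ≤
    nonZeroDivisors (MvPowerSeries (Fin p) k) := by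
  apply powers_le_nonZeroDivisors_of_noZeroDivisors
  rw [prod_ne_zero_iff]
  intro i _ h
  have h2 := congrArg (MvPowerSeries.coeff (Finsupp.single i 1)) h
  simp at h2

instance : IsDomain (LaurentQ p k) :=
  IsLocalization.isDomain_localization powers_prod_X_le

theorem algebraMap_laurentQ_injective :
    Function.Injective (algebraMap (MvPowerSeries (Fin p) k) (LaurentQ p k)) :=
  IsLocalization.injective _ powers_prod_X_le

theorem laurentX_injective : Function.Injective (laurentX p k) :=
  algebraMap_laurentQ_injective.comp X_injective

variable [Fact p.Prime]

theorem laurentCoeffHom_injective : Function.Injective (laurentCoeffHom p k) := by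
  rw [injective_iff_map_eq_zero]
  intro f hf
  obtain ⟨n, a, ha⟩ :=
    IsLocalization.Away.surj (MvPowerSeries.X (lastIdx p) : MvPowerSeries (Fin p) k) f
  have h := congrArg (laurentCoeffHom p k) ha
  rw [map_mul, hf, zero_mul, laurentCoeffHom_algebraMap, eq_comm,
    map_eq_zero_iff _ algebraMap_laurentQ_injective,
    map_eq_zero_iff _ taylorCoeffHom_injective] at h
  rw [h, map_zero] at ha
  exact ((IsLocalization.Away.algebraMap_pow_isUnit
    (MvPowerSeries.X (lastIdx p) : MvPowerSeries (Fin p) k) n).mul_left_eq_zero).mp ha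

variable [CharP k p]

instance : CharP (MvPowerSeries (Fin p) k) p :=
  charP_of_injective_ringHom (f := MvPowerSeries.C) MvPowerSeries.C_injective p

instance : CharP (LaurentQ p k) p :=
  charP_of_injective_ringHom algebraMap_laurentQ_injective p

theorem taylorHom_injective : Function.Injective (taylorHom p k) :=
  eval₂Hom_injective taylorCoeffHom_injective X_injective fun i => aeval_delta_esymm _ i

theorem laurentHom_injective : Function.Injective (laurentHom p k) :=
  eval₂Hom_injective laurentCoeffHom_injective laurentX_injective fun i =>
    aeval_delta_esymm (laurentX p k) i

end Injectivity

/-! ## Operators on Laurent series in characteristic `p` -/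

section Operators

variable {p : ℕ} {k : Type*} [Field k]

theorem coeff_negOne (f : LaurentSeries k) (n : ℤ) :
    (negOne p f).coeff n = (n : k) ^ (p - 2) * f.coeff n := by
  rw [negOne]
  induction p - 2 with
  | zero => simp
  | succ m ih =>
    rw [Function.iterate_succ_apply']
    change (n : k) * (theta^[m] f).coeff n = _
    rw [ih, pow_succ']
    ring

theorem exists_powerSeries_iff (f : LaurentSeries k) :
    (∃ ψ : PowerSeries k, algebraMap (PowerSeries k) (LaurentSeries k) ψ = f) ↔
      ∀ n < 0, f.coeff n = 0 := by
  constructor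
  · rintro ⟨ψ, rfl⟩ n hn
    rw [LaurentSeries.coe_algebraMap, PowerSeries.coeff_coe, if_pos hn]
  · intro h
    refine ⟨PowerSeries.mk fun n => f.coeff n, ?_⟩
    ext n
    rw [LaurentSeries.coe_algebraMap, PowerSeries.coeff_coe]
    split_ifs with hn
    · exact (h n hn).symm
    · rw [PowerSeries.coeff_mk, Int.natAbs_of_nonneg (not_lt.mp hn)]

theorem coeff_single_mul (f : LaurentSeries k) (m n : ℤ) :
    (HahnSeries.single m (1 : k) * f).coeff n = f.coeff (n - m) := by
  have h := HahnSeries.coeff_single_mul_add (r := (1 : k)) (x := f) (a := n - m) (b := m)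
  rwa [sub_add_cancel, one_mul] at h

theorem exists_X_mul_iff (f : LaurentSeries k) :
    (∃ ψ : PowerSeries k, algebraMap (PowerSeries k) (LaurentSeries k) (PowerSeries.X * ψ) = f) ↔
      ∀ n < 1, f.coeff n = 0 := by
  have h1 : HahnSeries.single (1 : ℤ) (1 : k) * HahnSeries.single (-1) 1 = 1 := by
    rw [HahnSeries.single_mul_single]
    simp
  have h2 : ∀ ψ : PowerSeries k, algebraMap (PowerSeries k) (LaurentSeries k)
      (PowerSeries.X * ψ) = f ↔
      algebraMap (PowerSeries k) (LaurentSeries k) ψ = HahnSeries.single (-1) 1 * f := by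
    intro ψ
    rw [map_mul, LaurentSeries.coe_algebraMap, HahnSeries.ofPowerSeries_X]
    constructor
    · rintro rfl
      rw [← mul_assoc, mul_comm (HahnSeries.single (-1) 1), h1, one_mul]
    · intro h
      rw [h, ← mul_assoc, h1, one_mul]
  simp only [h2]
  rw [exists_powerSeries_iff]
  simp only [coeff_single_mul]
  constructor
  · intro h n hn
    have := h (n - 1) (by omega)
    rwa [show n - 1 - -1 = n by ring] at this
  · intro h n hn
    exact h _ (by omega)

variable [Fact p.Prime]

theorem coeff_V_mul (f : LaurentSeries k) (n : ℤ) : (V p f).coeff (p * n) = f.coeff n :=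
  HahnSeries.embDomain_coeff

theorem coeff_V_of_not_dvd (f : LaurentSeries k) {n : ℤ} (h : ¬ (p : ℤ) ∣ n) :
    (V p f).coeff n = 0 := by
  apply HahnSeries.embDomain_notin_image_support
  rintro ⟨m, -, rfl⟩
  exact h (dvd_mul_right _ _)

theorem V_single (n : ℤ) (a : k) :
    V p (HahnSeries.single n a) = HahnSeries.single (p * n) a :=
  HahnSeries.embDomain_single

theorem coeff_iterate_V_mul (s : ℕ) (f : LaurentSeries k) (n : ℤ) :
    ((V p)^[s] f).coeff ((p : ℤ) ^ s * n) = f.coeff n := by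
  induction s with
  | zero => simp
  | succ s ih => rw [Function.iterate_succ_apply', pow_succ', mul_assoc, coeff_V_mul, ih]

theorem coeff_iterate_V_of_not_dvd (s : ℕ) (f : LaurentSeries k) {n : ℤ}
    (h : ¬ ((p : ℤ) ^ s) ∣ n) : ((V p)^[s] f).coeff n = 0 := by
  induction s generalizing n with
  | zero => simp at h
  | succ s ih =>
    rw [Function.iterate_succ_apply']
    by_cases hn : (p : ℤ) ∣ n
    · obtain ⟨m, rfl⟩ := hn
      rw [coeff_V_mul]
      apply ih
      intro hm
      exact h (by rw [pow_succ']; exact mul_dvd_mul_left _ hm)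
    · exact coeff_V_of_not_dvd _ hn

theorem coeff_U (f : LaurentSeries k) (n : ℤ) : (U p f).coeff n = f.coeff (p * n) := rfl

variable [CharP k p]

instance : CharP (LaurentSeries k) p :=
  charP_of_injective_ringHom (f := HahnSeries.C (Γ := ℤ)) HahnSeries.C_injective p

variable (p) in
/-- The Frobenius endomorphism of `k` applied to the coefficients. -/
def frobCoeff : LaurentSeries k →+* LaurentSeries k where
  toFun f := f.map (frobenius k p)
  map_zero' := by ext; simp
  map_one' := by
    ext n
    rw [HahnSeries.map_coeff, HahnSeries.coeff_one]
    split_ifs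
    · exact map_one _
    · exact map_zero _
  map_add' f g := by ext; simp
  map_mul' f g := HahnSeries.map_mul (frobenius k p : k →ₙ+* k)

theorem coeff_frobCoeff (f : LaurentSeries k) (n : ℤ) :
    (frobCoeff p f).coeff n = f.coeff n ^ p := rfl

theorem frobCoeff_V (f : LaurentSeries k) : frobCoeff p (V p f) = V p (frobCoeff p f) := by
  ext n
  rw [coeff_frobCoeff]
  by_cases hn : (p : ℤ) ∣ n
  · obtain ⟨m, rfl⟩ := hn
    rw [coeff_V_mul, coeff_V_mul, coeff_frobCoeff]
  · rw [coeff_V_of_not_dvd _ hn, coeff_V_of_not_dvd _ hn,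
      zero_pow (Fact.out : p.Prime).ne_zero]

theorem frobCoeff_U (f : LaurentSeries k) : frobCoeff p (U p f) = U p (frobCoeff p f) := by
  ext n
  rw [coeff_frobCoeff, coeff_U, coeff_U, coeff_frobCoeff]

theorem frobCoeff_negOne (f : LaurentSeries k) :
    frobCoeff p (negOne p f) = negOne p (frobCoeff p f) := by
  ext n
  have hn : (n : k) ^ p = n := map_intCast (frobenius k p) n
  rw [coeff_frobCoeff, coeff_negOne, coeff_negOne, coeff_frobCoeff, mul_pow, ← pow_mul,
    mul_comm (p - 2), pow_mul, hn]

theorem frobCoeff_single_one (n : ℤ) :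
    frobCoeff p (HahnSeries.single n (1 : k)) = HahnSeries.single n 1 := by
  ext m
  rw [coeff_frobCoeff, HahnSeries.coeff_single]
  split_ifs with h
  · rw [one_pow]
  · rw [zero_pow (Fact.out : p.Prime).ne_zero]

theorem coeff_algebraMap_pow_sub (n : ℤ) (N : ℕ) (χ : PowerSeries k) (h : n < p * N) :
    (algebraMap (PowerSeries k) (LaurentSeries k) χ ^ p -
      V p (frobCoeff p (algebraMap (PowerSeries k) (LaurentSeries k) χ))).coeff n = 0 := by
  have hp := (Fact.out : p.Prime)
  induction N generalizing χ n with
  | zero =>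
    have hn : n < 0 := by simpa using h
    have h1 : (algebraMap (PowerSeries k) (LaurentSeries k) χ ^ p).coeff n = 0 :=
      (exists_powerSeries_iff _).mp ⟨χ ^ p, map_pow _ _ _⟩ n hn
    rw [HahnSeries.coeff_sub, h1, zero_sub, neg_eq_zero]
    by_cases hd : (p : ℤ) ∣ n
    · obtain ⟨m, rfl⟩ := hd
      have hm : m < 0 := by
        have : (0 : ℤ) < p := by exact_mod_cast hp.pos
        by_contra hm
        nlinarith
      rw [coeff_V_mul, coeff_frobCoeff, (exists_powerSeries_iff _).mp ⟨χ, rfl⟩ m hm,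
        zero_pow hp.ne_zero]
    · exact coeff_V_of_not_dvd _ hd
  | succ N ih =>
    set A := algebraMap (PowerSeries k) (LaurentSeries k) with hA
    have hX : A PowerSeries.X = HahnSeries.single 1 1 := HahnSeries.ofPowerSeries_X
    have hC : ∀ a, A (PowerSeries.C a) = HahnSeries.single 0 a := fun a =>
      HahnSeries.ofPowerSeries_C a
    have hfC : ∀ a : k, frobCoeff p (HahnSeries.single 0 a) = HahnSeries.single 0 (a ^ p) := by
      intro a
      ext m
      rw [coeff_frobCoeff, HahnSeries.coeff_single, HahnSeries.coeff_single]
      split_ifs with h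
      · rfl
      · rw [zero_pow hp.ne_zero]
    -- Splitting off the constant term, on which both operations agree, leaves `q^p` times the same
    -- difference for the shifted series; so vanishing below `p * N` propagates to `p * (N + 1)`.
    have hs : A χ ^ p - V p (frobCoeff p (A χ)) =
        HahnSeries.single (p : ℤ) 1 * (A (shift 1 χ) ^ p - V p (frobCoeff p (A (shift 1 χ)))) := by
      conv_lhs => rw [eq_X_mul_shift_add χ]
      rw [map_add A, map_mul A, hX, hC, add_pow_char, map_add, map_mul, hfC, frobCoeff_single_one,
        map_add, map_mul, V_single, V_single, mul_one, mul_zero, mul_pow, HahnSeries.single_pow,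
        HahnSeries.single_pow]
      simp
      ring
    rw [hs, coeff_single_mul]
    apply ih
    push_cast at h
    linarith

theorem pow_char_eq_V (f : LaurentSeries k) : f ^ p = V p (frobCoeff p f) := by
  have hp := (Fact.out : p.Prime)
  have h : frobenius (LaurentSeries k) p = (V p).comp (frobCoeff p) := by
    apply IsLocalization.ringHom_ext (Submonoid.powers (PowerSeries.X : PowerSeries k))
    ext χ n
    rw [← sub_eq_zero]
    refine coeff_algebraMap_pow_sub n (n.toNat + 1) χ ?_
    have h1 : (1 : ℤ) ≤ p := by exact_mod_cast hp.one_le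
    have h2 := Int.self_le_toNat n
    push_cast
    nlinarith [Int.natCast_nonneg n.toNat]
  exact congrArg (fun g => g f) h

theorem pow_char_pow_eq_V (s : ℕ) (f : LaurentSeries k) :
    f ^ p ^ s = (V p)^[s] ((frobCoeff p)^[s] f) := by
  induction s generalizing f with
  | zero => simp
  | succ s ih =>
    have h : Function.Commute (frobCoeff p : LaurentSeries k → LaurentSeries k) (V p) :=
      frobCoeff_V
    rw [pow_succ, pow_mul, ih, pow_char_eq_V, (h.iterate_right s).eq,
      Function.iterate_succ_apply', Function.iterate_succ_apply']

theorem exists_iterate_frobCoeff [PerfectRing k p] (s : ℕ) (f : LaurentSeries k) :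
    ∃ g, (frobCoeff p)^[s] g = f := by
  have h : Function.Surjective (frobCoeff p : LaurentSeries k → LaurentSeries k) := by
    intro f
    refine ⟨f.map (frobeniusEquiv k p).symm, ?_⟩
    ext n
    rw [coeff_frobCoeff]
    exact frobenius_apply_frobeniusEquiv_symm k p _
  exact h.iterate s f

/-! ### Binomial coefficients -/

theorem choose_sub_one_eq (i : ℕ) (hi : i < p) :
    (((p - 1).choose i : ℕ) : k) = (-1) ^ i := by
  have hp := (Fact.out : p.Prime)
  induction i with
  | zero => simp
  | succ i ih =>
    have h : p.choose (i + 1) = (p - 1).choose i + (p - 1).choose (i + 1) := by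
      conv_lhs => rw [← Nat.sub_add_cancel hp.one_le, Nat.choose_succ_succ]
    have h0 : ((p.choose (i + 1) : ℕ) : k) = 0 :=
      (CharP.cast_eq_zero_iff k p _).mpr (hp.dvd_choose_self (Nat.succ_ne_zero i) hi)
    rw [h, Nat.cast_add, ih (by omega)] at h0
    rw [pow_succ]
    linear_combination h0

theorem natCast_pow_sub_one (i : ℕ) (hi : i + 1 < p) : ((i + 1 : ℕ) : k) ^ (p - 1) = 1 := by
  have h0 : ((i + 1 : ℕ) : k) ≠ 0 := by
    rw [Ne, CharP.cast_eq_zero_iff k p]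
    exact fun h => absurd (Nat.le_of_dvd (Nat.succ_pos i) h) (by omega)
  have h1 : ((i + 1 : ℕ) : k) ^ p = ((i + 1 : ℕ) : k) := map_natCast (frobenius k p) (i + 1)
  apply mul_left_cancel₀ h0
  rw [← pow_succ', Nat.sub_add_cancel (Fact.out : p.Prime).one_le, h1, mul_one]

/-- From `(i+1) * (choose p (i+1) / p) = choose (p-1) i`, which is `(-1)^i` in `k`; by Fermat the
inverse of `i + 1` is its power `p - 2`. This is the source of `θ^{p-2}`. -/
theorem choose_div_eq (hp2 : 2 < p) (i : ℕ) (hi : i + 1 < p) :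
    ((p.choose (i + 1) / p : ℕ) : k) = (-1) ^ i * ((i + 1 : ℕ) : k) ^ (p - 2) := by
  have hp := (Fact.out : p.Prime)
  obtain ⟨b, hb⟩ := hp.dvd_choose_self (Nat.succ_ne_zero i) hi
  have h1 : (i + 1) * b = (p - 1).choose i := by
    have h := Nat.add_one_mul_choose_eq (p - 1) i
    rw [Nat.sub_add_cancel hp.one_le, hb] at h
    have h2 : p * ((i + 1) * b) = p * (p - 1).choose i := by
      rw [h]
      ring
    exact Nat.eq_of_mul_eq_mul_left hp.pos h2
  have h2 := choose_sub_one_eq (k := k) i (by omega)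
  rw [← h1, Nat.cast_mul] at h2
  rw [hb, Nat.mul_div_cancel_left _ hp.pos, ← h2]
  have h3 := natCast_pow_sub_one (k := k) i hi
  rw [show p - 1 = p - 2 + 1 by omega, pow_succ] at h3
  linear_combination (-(b : k)) * h3

end Operators

/-! ## Preimages of the sums `Σ_p f` -/

section Preimages

variable {p : ℕ}

section Generic

variable {R Q : Type*} [CommRing R] [CommRing Q]

variable (p) in
/-- The preimage of `∑ χ(q_j)`, when `χ(q_j)` has expansion coefficients `c i`. -/
def constPreimage (s c : ℕ → R) : MvPolynomial (Fin p) R :=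
  MvPolynomial.C (∑ i ∈ range p, c i * (((p - i : ℕ) : R) * s i))

variable {τ : R →+* Q} {x : Fin p → Q} {s : ℕ → R}
  {D : Fin p → MvPolynomial (Fin p) Q}

theorem eval₂Hom_constPreimage (hs : ∀ n, τ (s n) = esymmAt x univ n)
    {u : Fin p → Q} {c : ℕ → R}
    (hu : ∀ j, u j = ∑ i ∈ range p, τ (c i) * esymmAt x (univ.erase j) i) :
    MvPolynomial.eval₂Hom (MvPolynomial.C.comp τ) D (constPreimage p s c) =
      ∑ j, MvPolynomial.C (u j) := by
  rw [constPreimage, MvPolynomial.eval₂Hom_C, RingHom.comp_apply, ← map_sum, map_sum,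
    sum_congr rfl fun j _ => hu j, sum_comm]
  congr 1
  refine sum_congr rfl fun i _ => ?_
  rw [← mul_sum, sum_esymmAt_erase, Fintype.card_fin, map_mul, map_mul, map_natCast, hs]

variable [Fact p.Prime] [Algebra ℤ R] [Algebra ℤ Q]

variable (p) in
/-- The preimage of `∑ (χ(q_j)) ^ p q_j'`, when `χ(q_j)` has expansion coefficients `c i`. -/
def linPreimage (s c : ℕ → R) : MvPolynomial (Fin p) R :=
  ∑ i : Fin p, MvPolynomial.C (c i ^ p) * (MvPolynomial.X i - MvPolynomial.C
    (MvPolynomial.aeval (fun l : Fin p => s (l + 1)) (powDefect p (i + 1))))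

/-- Frobenius passes through the expansion of `u j`; after exchanging the sums, the sum over `j` for
fixed `i` is the linear part of `D i`. -/
theorem eval₂Hom_linPreimage [CharP Q p] (hs : ∀ n, τ (s n) = esymmAt x univ n)
    (hD : ∀ i : Fin p, D i = ∑ j, MvPolynomial.C (esymmAt x (univ.erase j) i ^ p) *
      MvPolynomial.X j + MvPolynomial.C
        (MvPolynomial.aeval (fun l : Fin p => esymmAt x univ (l + 1)) (powDefect p (i + 1))))
    {u : Fin p → Q} {c : ℕ → R}
    (hu : ∀ j, u j = ∑ i ∈ range p, τ (c i) * esymmAt x (univ.erase j) i) :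
    MvPolynomial.eval₂Hom (MvPolynomial.C.comp τ) D (linPreimage p s c) =
      ∑ j, MvPolynomial.C (u j ^ p) * MvPolynomial.X j := by
  have h1 : ∀ j, MvPolynomial.C (u j ^ p) * MvPolynomial.X j =
      ∑ i : Fin p, MvPolynomial.C (τ (c i) ^ p) *
        (MvPolynomial.C (esymmAt x (univ.erase j) i ^ p) * MvPolynomial.X j) := by
    intro j
    rw [hu, sum_range, sum_pow_char, map_sum, sum_mul]
    refine sum_congr rfl fun i _ => ?_
    rw [mul_pow, map_mul, mul_assoc]
  rw [linPreimage, map_sum, sum_congr rfl fun j _ => h1 j, sum_comm]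
  refine sum_congr rfl fun i _ => ?_
  rw [map_mul, map_sub, MvPolynomial.eval₂Hom_X', MvPolynomial.eval₂Hom_C,
    MvPolynomial.eval₂Hom_C, RingHom.comp_apply, RingHom.comp_apply, map_aeval_int, hD]
  simp only [hs]
  rw [add_sub_cancel_right, mul_sum, map_pow]

end Generic

variable {k : Type*} [Field k]

theorem taylorSigma_add (f g : Polynomial (PowerSeries k)) :
    taylorSigma p (f + g) = taylorSigma p f + taylorSigma p g := by
  simp [taylorSigma, Polynomial.eval₂_add, sum_add_distrib]

theorem taylorSigma_sum {ι : Type*} (s : Finset ι) (f : ι → Polynomial (PowerSeries k)) :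
    taylorSigma p (∑ i ∈ s, f i) = ∑ i ∈ s, taylorSigma p (f i) := by
  simp only [taylorSigma, Polynomial.eval₂_finsetSum]
  exact sum_comm

theorem laurentSigma_add (f g : Polynomial (LaurentSeries k)) :
    laurentSigma p (f + g) = laurentSigma p f + laurentSigma p g := by
  simp [laurentSigma, Polynomial.eval₂_add, sum_add_distrib]

theorem laurentSigma_sum {ι : Type*} (s : Finset ι) (f : ι → Polynomial (LaurentSeries k)) :
    laurentSigma p (∑ i ∈ s, f i) = ∑ i ∈ s, laurentSigma p (f i) := by
  simp only [laurentSigma, Polynomial.eval₂_finsetSum]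
  exact sum_comm

variable [Fact p.Prime]

theorem taylorHom_constPreimage (χ : PowerSeries k) :
    taylorHom p k (constPreimage p (elemVar p k) (expCoeff p χ)) =
      taylorSigma p (Polynomial.C χ) := by
  rw [taylorHom, eval₂Hom_constPreimage (taylorCoeffHom_elemVar p k) (taylorVar_eq_expansion χ)]
  simp [taylorSigma]

theorem laurentHom_constPreimage {χ : LaurentSeries k} {c : ℕ → LaurentS p k}
    (h : IsExpansion χ c) :
    laurentHom p k (constPreimage p (fun n => algebraMap _ (LaurentS p k) (elemVar p k n)) c) =
      laurentSigma p (Polynomial.C χ) := by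
  rw [laurentHom, eval₂Hom_constPreimage laurentCoeffHom_elemVar h.1]
  simp [laurentSigma]

/-- The term `i = 0` carries the factor `p = 0`, and the others carry `s_i` with `0 < i < p`, which
specializes to zero. Hence `φ₀` does not contribute to `"pU"`. -/
theorem laurentSpec_constPreimage [CharP k p] (c : ℕ → LaurentS p k) :
    laurentSpec p k
      (constPreimage p (fun n => algebraMap _ (LaurentS p k) (elemVar p k n)) c) = 0 := by
  rw [constPreimage, laurentSpec, MvPolynomial.eval₂Hom_C, RingHom.comp_apply, map_sum,
    sum_eq_zero, map_zero]
  intro i hi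
  rw [map_mul, map_mul, map_natCast, laurentSpecCoeff_algebraMap, taylorSpecCoeff_elemVar]
  split_ifs with h0 hp
  · rw [h0, Nat.sub_zero, CharP.cast_eq_zero, zero_mul, mul_zero]
  · exact absurd hp (mem_range.mp hi).ne
  · rw [map_zero, mul_zero, mul_zero]

theorem laurentSpec_linPreimage_eq (hp2 : p ≠ 2) (c : ℕ → LaurentS p k) :
    laurentSpec p k (linPreimage p (fun n => algebraMap _ (LaurentS p k) (elemVar p k n)) c) =
      Polynomial.C (laurentSpecCoeff p k (c (lastIdx p)) ^ p) * Polynomial.X -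
        Polynomial.C (∑ i : Fin p, laurentSpecCoeff p k (c i) ^ p * if i = lastIdx p then 0 else
          ((p.choose (i + 1) / p : ℕ) : LaurentSeries k) *
            HahnSeries.single 1 1 ^ ((i : ℕ) + 1)) := by
  have hT : ∀ i : Fin p, laurentSpecCoeff p k (MvPolynomial.aeval (fun l : Fin p =>
      algebraMap _ (LaurentS p k) (elemVar p k ((l : ℕ) + 1))) (powDefect p ((i : ℕ) + 1))) =
      if i = lastIdx p then 0 else ((p.choose (i + 1) / p : ℕ) : LaurentSeries k) *
        HahnSeries.single 1 1 ^ ((i : ℕ) + 1) := by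
    intro i
    rw [map_aeval_int, ← aeval_powDefect_lastIdx hp2]
    congr 2
    funext l
    rw [laurentSpecCoeff_algebraMap, elemVar, dif_pos l.2, taylorSpecCoeff_X]
    split_ifs
    · exact HahnSeries.ofPowerSeries_X
    · exact map_zero _
  rw [linPreimage, map_sum, map_sum]
  have h1 : ∀ i : Fin p, laurentSpec p k (MvPolynomial.C (c i ^ p) * (MvPolynomial.X i -
      MvPolynomial.C (MvPolynomial.aeval (fun l : Fin p =>
        algebraMap _ (LaurentS p k) (elemVar p k ((l : ℕ) + 1))) (powDefect p ((i : ℕ) + 1))))) =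
      Polynomial.C (laurentSpecCoeff p k (c i) ^ p) * (if i = lastIdx p then Polynomial.X else 0) -
      Polynomial.C (laurentSpecCoeff p k (c i) ^ p * if i = lastIdx p then 0 else
          ((p.choose (i + 1) / p : ℕ) : LaurentSeries k) *
            HahnSeries.single 1 1 ^ ((i : ℕ) + 1)) := by
    intro i
    rw [← hT, laurentSpec, map_mul, map_sub, MvPolynomial.eval₂Hom_X', MvPolynomial.eval₂Hom_C,
      MvPolynomial.eval₂Hom_C, RingHom.comp_apply, RingHom.comp_apply, map_pow, map_mul, mul_sub]
  rw [sum_congr rfl fun i _ => h1 i, sum_sub_distrib]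
  simp

variable [CharP k p]

theorem taylorSigma_pow (f : Polynomial (PowerSeries k)) (s : ℕ) :
    taylorSigma p (f ^ p ^ s) = taylorSigma p f ^ p ^ s := by
  rw [taylorSigma, taylorSigma, sum_pow_char_pow]
  exact sum_congr rfl fun j _ => Polynomial.eval₂_pow _ _ _

theorem laurentSigma_pow (f : Polynomial (LaurentSeries k)) (s : ℕ) :
    laurentSigma p (f ^ p ^ s) = laurentSigma p f ^ p ^ s := by
  rw [laurentSigma, laurentSigma, sum_pow_char_pow]
  exact sum_congr rfl fun j _ => Polynomial.eval₂_pow _ _ _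

theorem taylorHom_linPreimage (χ : PowerSeries k) :
    taylorHom p k (linPreimage p (elemVar p k) (expCoeff p χ)) =
      taylorSigma p (Polynomial.C (χ ^ p) * Polynomial.X) := by
  rw [taylorHom, eval₂Hom_linPreimage (taylorCoeffHom_elemVar p k)
    (fun i => aeval_delta_esymm _ i) (taylorVar_eq_expansion χ)]
  simp [taylorSigma, Polynomial.eval₂_mul, Polynomial.eval₂_pow]

theorem laurentHom_linPreimage {χ : LaurentSeries k} {c : ℕ → LaurentS p k}
    (h : IsExpansion χ c) :
    laurentHom p k (linPreimage p (fun n => algebraMap _ (LaurentS p k) (elemVar p k n)) c) =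
      laurentSigma p (Polynomial.C (χ ^ p) * Polynomial.X) := by
  refine (eval₂Hom_linPreimage laurentCoeffHom_elemVar
    (fun i => aeval_delta_esymm (laurentX p k) i) h.1).trans ?_
  simp [laurentSigma, Polynomial.eval₂_mul, Polynomial.eval₂_pow]

/-- The summand with index `i` is supported on exponents congruent to `i + 1` mod `p`, so each
coefficient comes from at most one summand. The sign in the specialized `c i` cancels the one in
`choose_div_eq`. -/
theorem IsExpansion.sum_eq_negOne (hp2 : 2 < p) {ρ : LaurentSeries k} {c : ℕ → LaurentS p k}
    (h : IsExpansion (HahnSeries.single (-1) 1 * ρ) c) :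
    ∑ i : Fin p, laurentSpecCoeff p k (c i) ^ p * (if i = lastIdx p then 0 else
      ((p.choose (i + 1) / p : ℕ) : LaurentSeries k) * HahnSeries.single 1 1 ^ ((i : ℕ) + 1)) =
      negOne p (frobCoeff p ρ) := by
  have hp := (Fact.out : p.Prime)
  have hlast := lastIdx_val_add_one (p := p)
  ext n
  rw [coeff_negOne, coeff_frobCoeff, HahnSeries.coeff_sum]
  have hterm : ∀ i : Fin p, (laurentSpecCoeff p k (c i) ^ p * (if i = lastIdx p then 0 else
      ((p.choose (i + 1) / p : ℕ) : LaurentSeries k) *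
        HahnSeries.single 1 1 ^ ((i : ℕ) + 1))).coeff n =
      if i = lastIdx p then 0 else ((p.choose (i + 1) / p : ℕ) : k) *
        (V p (frobCoeff p (laurentSpecCoeff p k (c i)))).coeff (n - ((i : ℕ) + 1 : ℕ)) := by
    intro i
    split_ifs
    · rw [mul_zero, HahnSeries.coeff_zero]
    · rw [pow_char_eq_V, mul_comm, mul_assoc, ← nsmul_eq_mul, HahnSeries.coeff_nsmul,
        HahnSeries.single_pow, one_pow]
      rw [Pi.smul_apply, nsmul_eq_mul, coeff_single_mul]
      simp
  rw [sum_congr rfl fun i _ => hterm i]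
  -- If `p ∣ n`, the factor `n^(p-2)` kills the right side, and no `i + 1 < p` is congruent to `n`.
  -- Otherwise the residue of `n` selects `i`.
  by_cases hn : (p : ℤ) ∣ n
  · have h0 : (n : k) = 0 := (CharP.intCast_eq_zero_iff k p n).mpr hn
    rw [h0, zero_pow (by omega), zero_mul]
    refine sum_eq_zero fun i _ => ?_
    split_ifs with hi
    · rfl
    · rw [coeff_V_of_not_dvd, mul_zero]
      intro hd
      have hd2 : (p : ℤ) ∣ ((i : ℕ) + 1 : ℕ) := by
        have := dvd_sub hn hd
        rwa [sub_sub_cancel] at this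
      have hle := Nat.le_of_dvd (Nat.succ_pos _) (Int.natCast_dvd_natCast.mp hd2)
      apply hi
      apply Fin.ext
      have := i.2
      omega
  · have hp0 : (0 : ℤ) < p := by exact_mod_cast hp.pos
    obtain ⟨i, hi⟩ : ∃ i : ℕ, n % p = i + 1 := by
      refine ⟨(n % p - 1).toNat, ?_⟩
      have h1 := Int.emod_nonneg n hp0.ne'
      have h2 : n % p ≠ 0 := fun h2 => hn (Int.dvd_of_emod_eq_zero h2)
      omega
    have hip : i + 1 < p := by
      have := Int.emod_lt_of_pos n hp0
      omega
    have hdiv : n = p * (n / p) + ((i + 1 : ℕ) : ℤ) := by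
      have := Int.mul_ediv_add_emod n p
      push_cast
      omega
    set m := n / (p : ℤ)
    have hnk : (n : k) = ((i + 1 : ℕ) : k) := by
      rw [hdiv]
      push_cast
      rw [CharP.cast_eq_zero]
      ring
    have hsub : n - ((i + 1 : ℕ) : ℤ) = p * m := by
      rw [hdiv]
      ring
    have hρ : (laurentSpecCoeff p k (c i)).coeff m = (-1) ^ i * ρ.coeff n := by
      rw [h.2 i (by omega), coeff_single_mul, hdiv]
      congr 2
      push_cast
      ring
    have hodd : ((-1 : k) ^ i) ^ p = (-1) ^ i := by
      rw [← pow_mul, mul_comm, pow_mul, (hp.odd_of_ne_two (by omega)).neg_one_pow]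
    rw [sum_eq_single ⟨i, by omega⟩]
    · rw [if_neg (fun he => by
        have := congrArg Fin.val he
        simp only at this
        omega), hsub, coeff_V_mul, coeff_frobCoeff, hρ, hnk, choose_div_eq hp2 i hip, mul_pow, hodd]
      have hsq : ((-1 : k) ^ i) * (-1) ^ i = 1 := by
        rw [← mul_pow]
        simp
      linear_combination (((i + 1 : ℕ) : k) ^ (p - 2) * ρ.coeff n ^ p) * hsq
    · intro j _ hj
      split_ifs with hjl
      · rfl
      · rw [coeff_V_of_not_dvd, mul_zero]
        rintro ⟨t, ht⟩
        apply hj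
        apply Fin.ext
        have hj2 : (p : ℤ) ∣ ((i : ℤ) - (j : ℕ)) := by
          refine ⟨t - m, ?_⟩
          rw [mul_sub, ← ht, ← hsub]
          push_cast
          ring
        have h3 := j.2
        have h4 := Int.eq_zero_of_abs_lt_dvd hj2 (by rw [abs_lt]; omega)
        simp only
        omega
    · intro hni
      exact absurd (mem_univ _) hni

theorem laurentSpec_linPreimage (hp2 : 2 < p) {ρ : LaurentSeries k} {c : ℕ → LaurentS p k}
    (h : IsExpansion (HahnSeries.single (-1) 1 * ρ) c) :
    laurentSpec p k (linPreimage p (fun n => algebraMap _ (LaurentS p k) (elemVar p k n)) c) =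
      Polynomial.C (V p (U p (frobCoeff p ρ))) * qPrimeDiv p -
        Polynomial.C (negOne p (frobCoeff p ρ)) := by
  have hp := (Fact.out : p.Prime)
  have hlast := lastIdx_val_add_one (p := p)
  rw [laurentSpec_linPreimage_eq (by omega), h.sum_eq_negOne hp2]
  -- The top coefficient reads off `q⁻¹ρ` at `p r + (p - 1)`, that is `ρ` at `p (r + 1)`.
  have he : laurentSpecCoeff p k (c (lastIdx p)) = HahnSeries.single (-1) 1 * U p ρ := by
    ext r
    have heven : Even ((lastIdx p : Fin p) : ℕ) := hp.even_sub_one (by omega)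
    rw [h.2 _ (lastIdx p).2, heven.neg_one_pow, one_mul, coeff_single_mul, coeff_single_mul,
      coeff_U]
    congr 1
    have : (p : ℤ) = (lastIdx p : ℕ) + 1 := by exact_mod_cast hlast.symm
    linear_combination (-1 : ℤ) * this
  rw [he, pow_char_eq_V, map_mul, map_mul, frobCoeff_single_one, V_single, frobCoeff_U, qPrimeDiv,
    map_mul]
  simp only [mul_neg, mul_one]
  ring

end Preimages

/-! ## The series `φ₀ + ∑ V^{s+1}(φ_{p^s}) (q'/q^p)^{p^s}` -/

section Main

variable {p : ℕ} {k : Type*} [Field k]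

theorem term_eq (f : LaurentSeries k) (s : ℕ) :
    Polynomial.C f * qPrimeDiv p ^ p ^ s =
      Polynomial.monomial (p ^ s) (HahnSeries.single (-(p : ℤ) ^ (s + 1)) 1 * f) := by
  rw [qPrimeDiv, mul_pow, ← map_pow, HahnSeries.single_pow, one_pow, ← mul_assoc, ← map_mul,
    Polynomial.C_mul_X_pow_eq_monomial, mul_comm f]
  congr 3
  simp [pow_succ]

variable [Fact p.Prime]

theorem series_eq (φ₀ : LaurentSeries k) (φ : ℕ →₀ LaurentSeries k) :
    series p φ₀ φ = Polynomial.C φ₀ + ∑ s ∈ φ.support, Polynomial.monomial (p ^ s)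
      (HahnSeries.single (-(p : ℤ) ^ (s + 1)) 1 * (V p)^[s + 1] (φ s)) := by
  simp only [series, term_eq]

theorem coeff_series_zero (φ₀ : LaurentSeries k) (φ : ℕ →₀ LaurentSeries k) :
    (series p φ₀ φ).coeff 0 = φ₀ := by
  rw [series_eq, Polynomial.coeff_add, Polynomial.coeff_C_zero, Polynomial.finsetSum_coeff,
    sum_eq_zero, add_zero]
  intro s _
  rw [Polynomial.coeff_monomial, if_neg (pow_pos (Fact.out : p.Prime).pos s).ne']

theorem coeff_series_pow (φ₀ : LaurentSeries k) (φ : ℕ →₀ LaurentSeries k) (s : ℕ) :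
    (series p φ₀ φ).coeff (p ^ s) =
      HahnSeries.single (-(p : ℤ) ^ (s + 1)) 1 * (V p)^[s + 1] (φ s) := by
  rw [series_eq, Polynomial.coeff_add, Polynomial.coeff_C_of_ne_zero
    (pow_pos (Fact.out : p.Prime).pos s).ne', zero_add, Polynomial.finsetSum_coeff,
    sum_eq_single s]
  · rw [Polynomial.coeff_monomial, if_pos rfl]
  · intro t _ ht
    rw [Polynomial.coeff_monomial, if_neg]
    exact fun h => ht (Nat.pow_right_injective (Fact.out : p.Prime).two_le h)
  · intro hs
    rw [Finsupp.notMem_support_iff.mp hs, iterate_map_zero, mul_zero,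
      Polynomial.monomial_zero_right, Polynomial.coeff_zero]

/-- `V^{s+1} f` lives on multiples of `p^{s+1}`, so dividing by `q^{p^{s+1}}` leaves no pole exactly
when `f` has no term of exponent below `1`. -/
theorem exists_powerSeries_single_mul_iff (f : LaurentSeries k) (s : ℕ) :
    (∃ ψ : PowerSeries k, algebraMap (PowerSeries k) (LaurentSeries k) ψ =
      HahnSeries.single (-(p : ℤ) ^ (s + 1)) 1 * (V p)^[s + 1] f) ↔
      ∃ ψ : PowerSeries k,
        algebraMap (PowerSeries k) (LaurentSeries k) (PowerSeries.X * ψ) = f := by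
  have hpos : (0 : ℤ) < (p : ℤ) ^ (s + 1) :=
    pow_pos (by exact_mod_cast (Fact.out : p.Prime).pos) _
  rw [exists_powerSeries_iff, exists_X_mul_iff]
  simp only [coeff_single_mul, sub_neg_eq_add]
  constructor
  · intro h n hn
    have h2 := h ((p : ℤ) ^ (s + 1) * (n - 1)) (by nlinarith)
    rwa [show (p : ℤ) ^ (s + 1) * (n - 1) + (p : ℤ) ^ (s + 1) = (p : ℤ) ^ (s + 1) * n by ring,
      coeff_iterate_V_mul] at h2
  · intro h n hn
    by_cases hd : (p : ℤ) ^ (s + 1) ∣ n + (p : ℤ) ^ (s + 1)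
    · obtain ⟨m, hm⟩ := hd
      rw [hm, coeff_iterate_V_mul]
      apply h
      by_contra hm1
      nlinarith
    · exact coeff_iterate_V_of_not_dvd _ _ hd

theorem exists_map_eq_series_iff (φ₀ : LaurentSeries k) (φ : ℕ →₀ LaurentSeries k) :
    (∃ g : Polynomial (PowerSeries k),
        g.map (algebraMap (PowerSeries k) (LaurentSeries k)) = series p φ₀ φ) ↔
      (∃ ψ : PowerSeries k, algebraMap (PowerSeries k) (LaurentSeries k) ψ = φ₀) ∧
        ∀ s : ℕ, ∃ ψ : PowerSeries k,
          algebraMap (PowerSeries k) (LaurentSeries k) (PowerSeries.X * ψ) = φ s := by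
  rw [← forall_congr' fun s => exists_powerSeries_single_mul_iff (p := p) (φ s) s]
  constructor
  · rintro ⟨g, hg⟩
    refine ⟨⟨g.coeff 0, ?_⟩, fun s => ⟨g.coeff (p ^ s), ?_⟩⟩
    · rw [← Polynomial.coeff_map, hg, coeff_series_zero]
    · rw [← Polynomial.coeff_map, hg, coeff_series_pow]
  · rintro ⟨⟨ψ₀, h₀⟩, h⟩
    choose ψ hψ using h
    refine ⟨Polynomial.C ψ₀ + ∑ s ∈ φ.support, Polynomial.monomial (p ^ s) (ψ s), ?_⟩
    rw [Polynomial.map_add, Polynomial.map_C, h₀, Polynomial.map_sum, series_eq]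
    simp only [Polynomial.map_monomial, hψ]

variable [CharP k p] {φ₀ : LaurentSeries k} {φ : ℕ →₀ LaurentSeries k} {ρ : ℕ → LaurentSeries k}

/-- A power `p^{s+1}` of a Laurent series is `V^{s+1}` after Frobenius on coefficients, which `ρ s`
is chosen to undo. -/
theorem series_eq_sum_pow (hρ : ∀ s, (frobCoeff p)^[s + 1] (ρ s) = φ s) :
    series p φ₀ φ = Polynomial.C φ₀ + ∑ s ∈ φ.support,
      (Polynomial.C ((HahnSeries.single (-1) 1 * ρ s) ^ p) * Polynomial.X) ^ p ^ s := by
  rw [series_eq]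
  congr 1
  refine sum_congr rfl fun s _ => ?_
  rw [mul_pow, ← map_pow, ← pow_mul, ← pow_succ', Polynomial.C_mul_X_pow_eq_monomial, mul_pow,
    pow_char_pow_eq_V _ (ρ s), hρ, HahnSeries.single_pow, one_pow,
    show p ^ (s + 1) • (-1 : ℤ) = -(p : ℤ) ^ (s + 1) by simp]

theorem exists_laurentHom_eq (hp2 : 2 < p) (hρ : ∀ s, (frobCoeff p)^[s + 1] (ρ s) = φ s) :
    ∃ G : MvPolynomial (Fin p) (LaurentS p k), laurentHom p k G = laurentSigma p (series p φ₀ φ) ∧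
      laurentSpec p k G =
        -Polynomial.C (∑ s ∈ φ.support, (V p)^[s] (negOne p (φ s))) +
          ∑ s ∈ φ.support, Polynomial.C ((V p)^[s + 1] (U p (φ s))) * qPrimeDiv p ^ (p ^ s) := by
  obtain ⟨c₀, hc₀⟩ := exists_isExpansion (p := p) (by omega) φ₀
  choose c hc using fun s => exists_isExpansion (p := p) (by omega) (HahnSeries.single (-1) 1 * ρ s)
  refine ⟨constPreimage p (fun n => algebraMap _ (LaurentS p k) (elemVar p k n)) c₀ +
    ∑ s ∈ φ.support,
      linPreimage p (fun n => algebraMap _ (LaurentS p k) (elemVar p k n)) (c s) ^ p ^ s, ?_, ?_⟩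
  · rw [series_eq_sum_pow hρ, laurentSigma_add, laurentSigma_sum, map_add, map_sum,
      laurentHom_constPreimage hc₀]
    congr 1
    refine sum_congr rfl fun s _ => ?_
    rw [map_pow, laurentHom_linPreimage (hc s), laurentSigma_pow]
  · rw [map_add, laurentSpec_constPreimage, zero_add, map_sum, map_sum, ← sum_neg_distrib,
      ← sum_add_distrib]
    refine sum_congr rfl fun s _ => ?_
    have hF : Function.Commute (frobCoeff p : LaurentSeries k → LaurentSeries k) (U p) :=
      frobCoeff_U
    have hFV : Function.Commute (frobCoeff p : LaurentSeries k → LaurentSeries k) (V p) :=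
      frobCoeff_V
    have hFN : Function.Commute (frobCoeff p : LaurentSeries k → LaurentSeries k) (negOne p) :=
      frobCoeff_negOne
    -- Raising to `p^s` applies `V^s` together with `s` more coefficient Frobenii. These commute
    -- with `U`, `V` and `negOne`, and with the one already present they turn `ρ s` into `φ s`.
    rw [map_pow, laurentSpec_linPreimage hp2 (hc s), sub_pow_char_pow, mul_pow, ← Polynomial.C_pow,
      ← Polynomial.C_pow, pow_char_pow_eq_V, pow_char_pow_eq_V, (hFN.iterate_left s).eq,
      ← Function.iterate_succ_apply, hρ, (hFV.iterate_left s).eq, (hF.iterate_left s).eq,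
      ← Function.iterate_succ_apply, ← Function.iterate_succ_apply, hρ]
    ring

theorem isLaurentSymmetric_series (hp2 : 2 < p) (hρ : ∀ s, (frobCoeff p)^[s + 1] (ρ s) = φ s) :
    IsLaurentSymmetric p (series p φ₀ φ) := by
  obtain ⟨G, hG, -⟩ := exists_laurentHom_eq (φ₀ := φ₀) hp2 hρ
  exact ⟨G, hG, fun H hH => laurentHom_injective (hH.trans hG.symm)⟩

theorem pU_series (hp2 : 2 < p) (hρ : ∀ s, (frobCoeff p)^[s + 1] (ρ s) = φ s)
    (hf : IsLaurentSymmetric p (series p φ₀ φ)) :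
    pU (series p φ₀ φ) hf =
      -Polynomial.C (∑ s ∈ φ.support, (V p)^[s] (negOne p (φ s))) +
        ∑ s ∈ φ.support, Polynomial.C ((V p)^[s + 1] (U p (φ s))) * qPrimeDiv p ^ (p ^ s) := by
  obtain ⟨G, hG, hspec⟩ := exists_laurentHom_eq (φ₀ := φ₀) hp2 hρ
  rw [pU, laurentHom_injective (hf.choose_spec.1.trans hG.symm), hspec]

theorem coeff_iterate_frobCoeff (s : ℕ) (f : LaurentSeries k) (n : ℤ) :
    ((frobCoeff p)^[s] f).coeff n = f.coeff n ^ p ^ s := by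
  induction s with
  | zero => simp
  | succ s ih => rw [Function.iterate_succ_apply', coeff_frobCoeff, ih, ← pow_mul, ← pow_succ]

theorem isTaylorSymmetric_of_map_eq_series (hρ : ∀ s, (frobCoeff p)^[s + 1] (ρ s) = φ s)
    {g : Polynomial (PowerSeries k)}
    (hg : g.map (algebraMap (PowerSeries k) (LaurentSeries k)) = series p φ₀ φ) :
    IsTaylorSymmetric p g := by
  obtain ⟨⟨ψ₀, hψ₀⟩, h⟩ := (exists_map_eq_series_iff φ₀ φ).mp ⟨g, hg⟩
  -- Coefficients of `ρ s` vanish wherever those of `φ s` do, so `q⁻¹ρ` is a power series and the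
  -- preimages already exist without inverting `s_p`.
  have hχ : ∀ s, ∃ χ : PowerSeries k, algebraMap (PowerSeries k) (LaurentSeries k) χ =
      HahnSeries.single (-1) 1 * ρ s := by
    intro s
    rw [exists_powerSeries_iff]
    intro n hn
    rw [coeff_single_mul]
    have h1 := (exists_X_mul_iff (φ s)).mp (h s) (n - -1) (by omega)
    rw [← hρ, coeff_iterate_frobCoeff] at h1
    exact eq_zero_of_pow_eq_zero h1
  choose χ hχ using hχ
  have hgeq : g = Polynomial.C ψ₀ + ∑ s ∈ φ.support,
      (Polynomial.C (χ s ^ p) * Polynomial.X) ^ p ^ s := by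
    apply Polynomial.map_injective (algebraMap (PowerSeries k) (LaurentSeries k))
      (IsFractionRing.injective _ _)
    rw [hg, series_eq_sum_pow hρ]
    simp only [Polynomial.map_add, Polynomial.map_C, Polynomial.map_sum, Polynomial.map_pow,
      Polynomial.map_mul, Polynomial.map_X, map_pow, hψ₀, hχ]
  have hG : taylorHom p k (constPreimage p (elemVar p k) (expCoeff p ψ₀) + ∑ s ∈ φ.support,
      linPreimage p (elemVar p k) (expCoeff p (χ s)) ^ p ^ s) = taylorSigma p g := by
    rw [hgeq, taylorSigma_add, taylorSigma_sum, map_add, map_sum, taylorHom_constPreimage]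
    congr 1
    refine sum_congr rfl fun s _ => ?_
    rw [map_pow, taylorHom_linPreimage, taylorSigma_pow]
  exact ⟨_, hG, fun H hH => taylorHom_injective (hH.trans hG.symm)⟩

end Main

end

end DeltaSeries

theorem mainTheorem7 (p : ℕ) [Fact p.Prime] (hp : 5 ≤ p)
    (k : Type*) [Field k] [Algebra (ZMod p) k] [IsAlgClosure (ZMod p) k]
    (φ₀ : LaurentSeries k) (φ : ℕ →₀ LaurentSeries k) :
    (∃ hf : DeltaSeries.IsLaurentSymmetric p (DeltaSeries.series p φ₀ φ),
      DeltaSeries.pU (DeltaSeries.series p φ₀ φ) hf =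
        -Polynomial.C (∑ s ∈ φ.support, (DeltaSeries.V p)^[s] (DeltaSeries.negOne p (φ s))) +
          ∑ s ∈ φ.support,
            Polynomial.C ((DeltaSeries.V p)^[s + 1] (DeltaSeries.U p (φ s))) *
              DeltaSeries.qPrimeDiv p ^ (p ^ s)) ∧
    ((∃ g : Polynomial (PowerSeries k),
        g.map (algebraMap (PowerSeries k) (LaurentSeries k)) = DeltaSeries.series p φ₀ φ) ↔
      (∃ ψ : PowerSeries k, algebraMap (PowerSeries k) (LaurentSeries k) ψ = φ₀) ∧
        ∀ s : ℕ, ∃ ψ : PowerSeries k,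
          algebraMap (PowerSeries k) (LaurentSeries k) (PowerSeries.X * ψ) = φ s) ∧
    (∀ g : Polynomial (PowerSeries k),
      g.map (algebraMap (PowerSeries k) (LaurentSeries k)) = DeltaSeries.series p φ₀ φ →
        DeltaSeries.IsTaylorSymmetric p g) := by
  have : CharP k p := charP_of_injective_algebraMap (algebraMap (ZMod p) k).injective p
  have : IsAlgClosed k := IsAlgClosure.isAlgClosed (ZMod p)
  -- The algebraically closed field `k` is perfect, so the coefficients of `φ s` have roots of order
  -- `p^{s+1}`.
  choose ρ hρ using fun s => DeltaSeries.exists_iterate_frobCoeff (p := p) (s + 1) (φ s)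
  have hf := DeltaSeries.isLaurentSymmetric_series (φ₀ := φ₀) (by omega) hρ
  exact ⟨⟨hf, DeltaSeries.pU_series (by omega) hρ hf⟩, DeltaSeries.exists_map_eq_series_iff φ₀ φ,
    fun g hg => DeltaSeries.isTaylorSymmetric_of_map_eq_series hρ hg⟩
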